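/- Let $n\ge 1$ and let $Y_n=\{1,\dots,n\}\times\mathbb{N}$, where $\mathbb N=\{1,2,\dots\}$. Let $\mathcal{M}_n$ be the monoid of all injective maps $\alpha:Y_n\to Y_n$, acting on the right (so $\alpha\beta$ means $\alpha$ followed by $\beta$), for which there are $(m_1,\dots,m_n)\in\mathbb{Z}^n$ and a finite set $K\subset Y_n$ such that $(k,p)\alpha=(k,p+m_k)$ for all $(k,p)\in Y_n\setminus K$. For $1\le i\le n$ let $t_i\in\mathcal{M}_n$ be given by $(i,p)t_i=(i,p+1)$ and $(j,p)t_i=(j,p)$ for $j\ne i$. Let $\mathcal{C}_n$ be the graph with vertex set $\mathcal{M}_n$ and one edge joining $\alpha$ to $t_i\alpha$ for each $\alpha\in\mathcal{M}_n$ and each $i$. Let $X_n$ be the space with $X_n^{(1)}=\mathcal{C}_n$ in which, for each $k\ge 2$, $X_n^{(k)}$ is obtained from $X_n^{(k-1)}$ by attaching one $k$-cube along every copy of the boundary of a $k$-cube in $X_n^{(k-1)}$, with the weak topology. A cubical complex is a (Hausdorff) CW complex whose cells are cubes such that each attaching map $\varphi:\partial I^k\to X^{(k-1)}$ is a homeomorphism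 onto its image and maps each facet of $I^k$ isomorphically (by an isometry of cubes) onto a $(k-1)$-cube. The link of a vertex $v$ is the union, over all cubes $\sigma$ containing $v$, of the simplices spanned by the edges of $\sigma$ at $v$. It is a flag complex if it is a simplicial complex and every nonempty collection of pairwise adjacent vertices spans a simplex. A cubing is a simply connected cubical complex in which the link of every vertex is a flag complex (that is, which is non-positively curved in the sense of Gromov's link condition). **Theorem.** For every $n\ge 1$, $X_n$ with its cubes is a cubing: it is a cubical complex, it is simply connected, and the link of each of its vertices is a flag complex. -/

import Mathlib

open Set Metric Topology

/-! ### The monoid of eventually translating injections of `n` rays -/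

/-- `n` disjoint copies of the positive integers. The element `(k, p)`, with `p : ℕ` counted from
`0`, is the point at distance `p + 1` from the origin on the `k`-th ray. -/
abbrev Rays (n : ℕ) : Type := Fin n × ℕ

/-- Outside a finite set, `f` translates the `k`-th ray by `m k`. -/
def IsEventualTranslation {n : ℕ} (f : Rays n → Rays n) : Prop :=
  ∃ (m : Fin n → ℤ) (K : Finset (Rays n)), ∀ (k : Fin n) (p : ℕ), (k, p) ∉ K →
    (f (k, p)).1 = k ∧ ((f (k, p)).2 : ℤ) = p + m k

/-- The set `𝓜ₙ` of injective eventual translations of the `n` rays. -/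
def HoughtonMonoid (n : ℕ) : Type :=
  {f : Rays n → Rays n // Function.Injective f ∧ IsEventualTranslation f}

namespace HoughtonMonoid

theorem isEventualTranslation_comp {n : ℕ} {f g : Rays n → Rays n} (hf : Function.Injective f)
    (hft : IsEventualTranslation f) (hgt : IsEventualTranslation g) :
    IsEventualTranslation (g ∘ f) := by
  classical
  obtain ⟨m, K, hK⟩ := hft
  obtain ⟨m', K', hK'⟩ := hgt
  refine ⟨fun k => m k + m' k, K ∪ K'.preimage f hf.injOn, fun k p hkp => ?_⟩
  simp only [Finset.mem_union, Finset.mem_preimage, not_or] at hkp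
  obtain ⟨h1, h2⟩ := hK k p hkp.1
  have h3 : (k, (f (k, p)).2) = f (k, p) := Prod.ext h1.symm rfl
  obtain ⟨h4, h5⟩ := hK' k (f (k, p)).2 (by rw [h3]; exact hkp.2)
  rw [h3] at h4 h5
  refine ⟨h4, ?_⟩
  simp only [Function.comp_apply]
  rw [h5, h2]
  ring

/-- Maps act on the right: `α * β` is `α` followed by `β`. -/
instance (n : ℕ) : Monoid (HoughtonMonoid n) where
  mul α β := ⟨β.1 ∘ α.1, β.2.1.comp α.2.1, isEventualTranslation_comp α.2.1 α.2.2 β.2.2⟩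
  one := ⟨id, Function.injective_id, 0, ∅, fun k p _ => ⟨rfl, by simp⟩⟩
  mul_assoc _ _ _ := rfl
  one_mul _ := rfl
  mul_one _ := rfl

/-- The generator `tᵢ`: translation by `1` on the `i`-th ray, identity on the other rays. -/
def t {n : ℕ} (i : Fin n) : HoughtonMonoid n :=
  ⟨fun y => if y.1 = i then (y.1, y.2 + 1) else y, by
    rintro ⟨a, p⟩ ⟨b, q⟩ h
    dsimp only at h
    split_ifs at h <;> simp_all [Prod.ext_iff], by
    refine ⟨fun k => if k = i then 1 else 0, ∅, fun k p _ => ?_⟩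
    by_cases h : k = i <;> simp [h]⟩

theorem mul_apply {n : ℕ} (α β : HoughtonMonoid n) (y : Rays n) : (α * β).1 y = β.1 (α.1 y) := rfl

/-- The Cayley graph has no loops. -/
theorem t_mul_ne {n : ℕ} (i : Fin n) (α : HoughtonMonoid n) : t i * α ≠ α := by
  intro h
  have h1 : (t i * α).1 (i, 0) = α.1 (i, 0) := by rw [h]
  rw [mul_apply] at h1
  simpa [t] using α.2.1 h1

/-- The Cayley graph has no multiple edges: the end points of an edge determine its label. -/
theorem t_mul_injective {n : ℕ} {i j : Fin n} {α : HoughtonMonoid n} (h : t i * α = t j * α) :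
    i = j := by
  have h1 : (t i * α).1 (i, 0) = (t j * α).1 (i, 0) := by rw [h]
  rw [mul_apply, mul_apply] at h1
  by_contra hij
  simpa [t, hij] using α.2.1 h1

end HoughtonMonoid

/-- The Cayley graph `𝓒ₙ`: the vertices are the elements of `𝓜ₙ`, with an edge from `α` to `tᵢ α`
for all `α` and `i`. The orientation is forgotten; since there are no loops and no multiple edges
(`HoughtonMonoid.t_mul_ne`, `HoughtonMonoid.t_mul_injective`) this is a simple graph. -/
def cayleyGraph (n : ℕ) : SimpleGraph (HoughtonMonoid n) :=
  SimpleGraph.fromRel fun α β => ∃ i : Fin n, β = HoughtonMonoid.t i * α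

/-! ### Filling all cubes in a graph -/

/-- The 1-skeleton of the `k`-cube `[-1, 1]ᵏ`: its vertices are the sign vectors, two of them
being adjacent if they differ in exactly one coordinate. -/
def cubeGraph (k : ℕ) : SimpleGraph (Fin k → ℤˣ) where
  Adj u v := hammingDist u v = 1
  symm := ⟨fun u v h => by rwa [hammingDist_comm]⟩
  loopless := ⟨fun u h => by simp at h⟩

/-- The solid cube `[-1, 1]ᵏ`, as the closed unit ball of `ℝᵏ` for the sup norm. -/
abbrev SolidCube (k : ℕ) : Type := closedBall (0 : Fin k → ℝ) 1

/-- A parametrized `k`-cube in a graph: an injective graph homomorphism from the 1-skeleton of the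
`k`-cube. -/
abbrev ParamCube {V : Type} (G : SimpleGraph V) : Type :=
  Σ k : ℕ, SimpleGraph.Copy (cubeGraph k) G

/-- The affine map `[-1, 1]ʲ → [-1, 1]ᵏ` onto a face: the `a`-th coordinate, up to the sign `s a`,
becomes the `ι a`-th coordinate, and the other coordinates are constants given by `c`.
It is used for points (`R = ℝ`) and for vertices (`R = ℤˣ`). -/
noncomputable def faceMap {R : Type} [Mul R] {j k : ℕ} (ι : Fin j ↪ Fin k) (s : Fin j → R)
    (c : Fin k → R) (x : Fin j → R) : Fin k → R :=
  Function.extend ι (fun a => s a * x a) c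

/-- The point `p` of a parametrized cube is glued to the point `q` of another one if the first cube
is a face of the second one (in any parametrization; possibly the whole cube) and the inclusion
of this face maps `p` to `q`. -/
def IsGlued {V : Type} (G : SimpleGraph V) (p q : Σ f : ParamCube G, SolidCube f.1) : Prop :=
  ∃ (ι : Fin p.1.1 ↪ Fin q.1.1) (s : Fin p.1.1 → ℤˣ) (c : Fin q.1.1 → ℤˣ),
    (∀ ε : Fin p.1.1 → ℤˣ, p.1.2 ε = q.1.2 (faceMap ι s c ε)) ∧
    (q.2 : Fin q.1.1 → ℝ) =
      faceMap ι (fun a => ((s a : ℤ) : ℝ)) (fun b => ((c b : ℤ) : ℝ)) (p.2 : Fin p.1.1 → ℝ)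

/-- The space obtained from a simple graph `G` by attaching, inductively for `k = 2, 3, …`, one
`k`-cube along every copy of the boundary of the `k`-cube in the `(k-1)`-skeleton, with the weak
topology. By induction each copy of the boundary of the `k`-cube in the `(k-1)`-skeleton consists
of the cubes already attached to the proper faces of a copy in `G` of the 1-skeleton of the
`k`-cube. So one takes a solid cube for each parametrized cube in `G` (for `k = 0` and `k = 1` these
are the vertices and edges of `G`) and glues along all face inclusions, including the symmetries
of the `k`-cube, which identify the different parametrizations of the same subgraph. -/
def CubeFilling {V : Type} (G : SimpleGraph V) : Type := Quot (IsGlued G)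

/-- The quotient topology from the disjoint union of all cubes. -/
instance {V : Type} (G : SimpleGraph V) : TopologicalSpace (CubeFilling G) :=
  inferInstanceAs (TopologicalSpace (Quot (IsGlued G)))

/-- The characteristic map of a parametrized cube. -/
def CubeFilling.charMap {V : Type} {G : SimpleGraph V} (f : ParamCube G) (x : SolidCube f.1) :
    CubeFilling G :=
  Quot.mk (IsGlued G) ⟨f, x⟩

/-! ### Cubical complexes, links, cubings -/

universe u

/-- A cubical complex: a Hausdorff space with a CW structure (characteristic maps are defined on
`[-1, 1]ᵏ`, the closed unit ball for the sup norm) such that the attaching map of every cell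
* maps each facet `{y | y a = σ}` of the cube isomorphically (by a linear isometry of
  `[-1, 1]ᵏ`, i.e. a signed permutation of the coordinates) onto a cell of one dimension lower;
* is a homeomorphism from the boundary of the cube onto its image. -/
structure CubicalComplex (X : Type u) [TopologicalSpace X] extends CWComplex (univ : Set X) where
  t2Space : T2Space X
  exists_facet : ∀ (k : ℕ) (i : cell (k + 1)) (a : Fin (k + 1)) (σ : ℤˣ),
    ∃ (j : cell k) (A : (Fin k → ℝ) ≃ₗᵢ[ℝ] (Fin k → ℝ)), ∀ x ∈ closedBall (0 : Fin k → ℝ) 1,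
      map (k + 1) i (Fin.insertNth (α := fun _ => ℝ) a ((σ : ℤ) : ℝ) x) = map k j (A x)
  isEmbedding_attach : ∀ (k : ℕ) (i : cell k),
    IsEmbedding ((sphere (0 : Fin k → ℝ) 1).domRestrict (map k i))

/-- A simplicial complex is flag if every nonempty collection of pairwise adjacent vertices spans
a simplex. -/
def AbstractSimplicialComplex.IsFlag {W : Type u} (L : AbstractSimplicialComplex W) : Prop :=
  ∀ S : Set W, S.Nonempty →
    (∀ v ∈ S, ∀ w ∈ S, v ≠ w → ∃ e ∈ L.faces, (e : Set W) = {v, w}) →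
    ∃ s ∈ L.faces, (s : Set W) = S

namespace CubicalComplex

variable {X : Type u} [TopologicalSpace X] (K : CubicalComplex X)

/-- The closed `k`-cube of the complex with index `i`. -/
def cube (k : ℕ) (i : K.cell k) : Set X := K.map k i '' closedBall 0 1

/-- The point of `X` given by a 0-cell. -/
def point (v : K.cell 0) : X := K.map 0 v 0

/-- The vertices of the link of `v`: the edges containing `v` (as attaching maps are injective,
an edge has only one end at `v`). -/
abbrev LinkVertex (v : K.cell 0) : Type u := {e : K.cell 1 // K.point v ∈ K.cube 1 e}

/-- The cubes of all dimensions containing `v`. As attaching maps are injective, such a cube has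
exactly one corner at `v`. -/
abbrev Star (v : K.cell 0) : Type u := {c : Σ k, K.cell k // K.point v ∈ K.cube c.1 c.2}

/-- The link of `v` in a `k`-cube containing `v` is a `(k-1)`-simplex; its vertices are given by
the edges of this cube at `v`. For `k = 0` it is empty. -/
def linkSimplex (v : K.cell 0) (c : K.Star v) : Set (K.LinkVertex v) :=
  {e | K.cube 1 e.1 ⊆ K.cube c.1.1 c.1.2}

/-- The link of `v`, the union of the links of `v` in all cubes containing `v`, is a flag simplicial
complex. That it is a simplicial complex means that the simplices coming from different cubes have
different sets of vertices, and that these vertex sets are the faces of an abstract simplicial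
complex. -/
def HasFlagLink (v : K.cell 0) : Prop :=
  Function.Injective (K.linkSimplex v) ∧
  ∃ L : AbstractSimplicialComplex (K.LinkVertex v),
    (∀ s : Finset (K.LinkVertex v),
      s ∈ L.faces ↔ s.Nonempty ∧ ∃ c : K.Star v, K.linkSimplex v c = (s : Set (K.LinkVertex v))) ∧
    L.IsFlag

/-- Gromov's link condition: all vertex links are flag complexes. -/
def IsNonpositivelyCurved : Prop := ∀ v : K.cell 0, K.HasFlagLink v

/-- A cubing is a simply connected nonpositively curved cubical complex. -/
structure IsCubing : Prop where
  simplyConnected : SimplyConnectedSpace X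
  nonpositivelyCurved : K.IsNonpositivelyCurved

end CubicalComplex

/-- The cubical structure `K` on `CubeFilling G` is the one from the construction: the `k`-cells
correspond bijectively to the copies in `G` of the 1-skeleton of the `k`-cube, and each
characteristic map is that of a parametrization of the corresponding copy. -/
def CubeFilling.IsStandard {V : Type} {G : SimpleGraph V} (K : CubicalComplex (CubeFilling G)) :
    Prop :=
  ∀ k : ℕ, ∃ e : K.cell k ≃ {H : G.Subgraph // Nonempty (cubeGraph k ≃g H.coe)},
    ∀ i : K.cell k, ∃ f : SimpleGraph.Copy (cubeGraph k) G, f.toSubgraph = (e i).1 ∧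
      ∀ x : SolidCube k, K.map k i x = CubeFilling.charMap ⟨k, f⟩ x

/-- The cubical complex `Xₙ`: the Cayley graph `𝓒ₙ` with all cubes filled. -/
abbrev HoughtonComplex (n : ℕ) : Type := CubeFilling (cayleyGraph n)

/-!
The submonoid generated by the `tᵢ` is `ℕⁿ`; it acts freely on `𝓜ₙ` by left multiplication, and the
shift `𝓜ₙ → ℤⁿ` turns this action into translation. Two elements with the same shift and two common
neighbours would agree on all rays, so every square of `𝓒ₙ` is a parallelogram over `ℤⁿ`. Therefore
every cube of `𝓒ₙ` is given by its lowest vertex and a set of directions, and the orbit `ℕⁿ α` spans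
an orthant `[0, ∞)ⁿ` in `Xₙ`. Each point has a unique normal form: a vertex `α` together with a
vector in `[0, 1)ⁿ` in the orthant of `α`. This gives the cell structure.

Any two orthants meet, and flowing along the diagonal `(1, …, 1)` moves every compact subset of `Xₙ`
into a single orthant, which is contractible; hence `Xₙ` is simply connected.

An edge at a vertex `α` in direction `i` either goes up, or goes down and inserts a value outside
the range of `α` at the beginning of the `i`-th ray. Edges in different directions whose inserted
values are pairwise distinct can be followed simultaneously, so the link of `α` is the clique
complex of its 1-skeleton.
-/

/-! ### The action of `ℕⁿ` on the monoid -/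

namespace HoughtonMonoid

variable {n : ℕ} {α β γ δ : HoughtonMonoid n} {i j : Fin n}

@[ext]
theorem ext (h : ∀ k p, α.1 (k, p) = β.1 (k, p)) : α = β :=
  Subtype.ext (funext fun y => h y.1 y.2)

theorem translate_injective (a : Fin n → ℕ) :
    Function.Injective fun y : Rays n => (y.1, y.2 + a y.1) := by
  rintro ⟨k, p⟩ ⟨l, q⟩ h
  obtain ⟨rfl, h⟩ := Prod.mk.inj h
  exact Prod.ext rfl (Nat.add_right_cancel h)

/-- The monoid `ℕⁿ` acts on `𝓜ₙ` through the commuting generators: `a +ᵥ α` stands for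
`t₁^{a₁} ⋯ tₙ^{aₙ} α`, which forgets the first `a k` values of `α` on the `k`-th ray. -/
instance : AddAction (Fin n → ℕ) (HoughtonMonoid n) where
  vadd a α := ⟨fun y => α.1 (y.1, y.2 + a y.1), α.2.1.comp (translate_injective a), by
    obtain ⟨-, m, K, hK⟩ := α.2
    refine ⟨fun k => m k + a k, K.preimage _ (translate_injective a).injOn, fun k p hkp => ?_⟩
    obtain ⟨hray, hpos⟩ := hK k (p + a k) (by simpa using hkp)
    refine ⟨hray, hpos.trans ?_⟩
    push_cast
    ring⟩
  zero_vadd _ := rfl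
  add_vadd a b α := ext fun k p => by
    change α.1 (k, p + (a k + b k)) = α.1 (k, p + a k + b k)
    rw [add_assoc]

theorem vadd_apply (a : Fin n → ℕ) (α : HoughtonMonoid n) (k : Fin n) (p : ℕ) :
    (a +ᵥ α).1 (k, p) = α.1 (k, p + a k) := rfl

theorem t_mul (i : Fin n) (α : HoughtonMonoid n) :
    t i * α = (Pi.single i 1 : Fin n → ℕ) +ᵥ α := by
  refine ext fun k p => ?_
  rw [mul_apply, vadd_apply]
  obtain rfl | h := eq_or_ne k i
  · simp [t]
  · simp [t, h]

theorem exists_eq_add_of_le (α : HoughtonMonoid n) :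
    ∃ (m : Fin n → ℤ) (N : ℕ), ∀ k p, N ≤ p →
      (α.1 (k, p)).1 = k ∧ ((α.1 (k, p)).2 : ℤ) = p + m k := by
  obtain ⟨-, m, K, hK⟩ := α.2
  refine ⟨m, K.sup (fun y => y.2 + 1), fun k p hp => hK k p fun hmem => ?_⟩
  have : p + 1 ≤ K.sup fun y => y.2 + 1 := Finset.le_sup (f := fun y : Rays n => y.2 + 1) hmem
  omega

/-- The translation vector `(m₁, …, mₙ)` of an eventual translation. -/
noncomputable def shift (α : HoughtonMonoid n) : Fin n → ℤ := α.exists_eq_add_of_le.choose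

theorem exists_eq_add_shift (α : HoughtonMonoid n) : ∃ N : ℕ, ∀ k p, N ≤ p →
    (α.1 (k, p)).1 = k ∧ ((α.1 (k, p)).2 : ℤ) = p + α.shift k :=
  α.exists_eq_add_of_le.choose_spec

theorem shift_vadd (a : Fin n → ℕ) (α : HoughtonMonoid n) (k : Fin n) :
    (a +ᵥ α).shift k = α.shift k + a k := by
  obtain ⟨N, hN⟩ := α.exists_eq_add_shift
  obtain ⟨N', hN'⟩ := (a +ᵥ α).exists_eq_add_shift
  have h := (hN' k (N + N') (by omega)).2
  rw [vadd_apply, (hN k (N + N' + a k) (by omega)).2] at h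
  push_cast at h
  linarith

theorem shift_t_mul (i : Fin n) (α : HoughtonMonoid n) :
    (t i * α).shift = α.shift + Pi.single i 1 := by
  funext k
  obtain rfl | hk := eq_or_ne k i
  · simp [t_mul, shift_vadd]
  · simp [t_mul, shift_vadd, hk]

theorem vadd_left_injective (α : HoughtonMonoid n) :
    Function.Injective fun a : Fin n → ℕ => a +ᵥ α := by
  intro a b h
  funext k
  have := congrArg (fun β => shift β k) h
  simp only [shift_vadd] at this
  omega

theorem exists_const_vadd_eq_vadd (α β : HoughtonMonoid n) :
    ∃ (N : ℕ) (b : Fin n → ℕ), (fun _ => N : Fin n → ℕ) +ᵥ α = b +ᵥ β := by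
  obtain ⟨N, hN⟩ := α.exists_eq_add_shift
  obtain ⟨N', hN'⟩ := β.exists_eq_add_shift
  obtain ⟨C, hC⟩ : ∃ C : ℕ, ∀ k, (α.shift k - β.shift k).natAbs ≤ C :=
    ⟨∑ k, (α.shift k - β.shift k).natAbs, fun k =>
      Finset.single_le_sum (f := fun k => (α.shift k - β.shift k).natAbs)
        (fun _ _ => Nat.zero_le _) (Finset.mem_univ k)⟩
  refine ⟨N + N' + C, fun k => N + N' + (α.shift k - β.shift k + C).toNat, ext fun k p => ?_⟩
  have hk := hC k
  obtain ⟨hα₁, hα₂⟩ := hN k (p + (N + N' + C)) (by omega)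
  obtain ⟨hβ₁, hβ₂⟩ := hN' k (p + (N + N' + (α.shift k - β.shift k + C).toNat)) (by omega)
  rw [vadd_apply, vadd_apply]
  refine Prod.ext (hα₁.trans hβ₁.symm) ?_
  omega

theorem eq_of_t_mul_eq (hij : i ≠ j)
    (hi : t i * α = t i * β)
    (hj : t j * α = t j * β) : α = β := by
  refine ext fun k p => ?_
  obtain rfl | hk := eq_or_ne k i
  · simpa [t_mul, vadd_apply, hij] using congrArg (fun γ => γ.1 (k, p)) hj
  · simpa [t_mul, vadd_apply, hk] using congrArg (fun γ => γ.1 (k, p)) hi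

end HoughtonMonoid

/-! ### Squares in the Cayley graph -/

/-- A closed walk of length four along the axes of a lattice whose diagonals do not degenerate goes
around a parallelogram. -/
theorem single_eq_single_of_add_eq_add {ι : Type*} [DecidableEq ι] {i j k l : ι} {p q r s : ℤˣ}
    (h : (Pi.single i (p : ℤ) + Pi.single k (q : ℤ) : ι → ℤ) = Pi.single j ↑r + Pi.single l ↑s)
    (hne : (Pi.single i (p : ℤ) : ι → ℤ) ≠ Pi.single j ↑r)
    (hsum : (Pi.single i (p : ℤ) + Pi.single k (q : ℤ) : ι → ℤ) ≠ 0) :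
    i ≠ j ∧ (Pi.single k (q : ℤ) : ι → ℤ) = Pi.single j ↑r := by
  have hi := congrFun h i
  simp only [Pi.add_apply, Pi.single_apply] at hi
  have hp := Int.isUnit_iff.1 p.isUnit
  have hq := Int.isUnit_iff.1 q.isUnit
  have hr := Int.isUnit_iff.1 r.isUnit
  have hs := Int.isUnit_iff.1 s.isUnit
  have hij : i ≠ j := by
    rintro rfl
    have hpr : (p : ℤ) ≠ r := fun hpr => hne (by rw [hpr])
    have hkq : i = k ∧ (q : ℤ) = -p := by
      clear h hne hsum
      grind
    exact hsum (by rw [← hkq.1, hkq.2, Pi.single_neg, add_neg_cancel])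
  have hik : i ≠ k := by
    rintro rfl
    have hpq : (q : ℤ) = -p := by
      clear h hne hsum
      grind
    exact hsum (by rw [hpq, Pi.single_neg, add_neg_cancel])
  have hil : i = l ∧ (p : ℤ) = s := by
    clear h hne hsum
    grind
  refine ⟨hij, ?_⟩
  rwa [← hil.1, ← hil.2, add_comm, add_left_inj] at h

namespace HoughtonMonoid

variable {n : ℕ} {α β γ δ : HoughtonMonoid n} {i j : Fin n}

theorem adj_iff : (cayleyGraph n).Adj α β ↔
    ∃ i, β = t i * α ∨ α = t i * β := by
  simp only [cayleyGraph, SimpleGraph.fromRel_adj, exists_or, and_iff_right_iff_imp]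
  rintro (⟨i, rfl⟩ | ⟨i, rfl⟩)
  exacts [(t_mul_ne i α).symm, t_mul_ne i β]

theorem exists_shift_eq_of_adj (h : (cayleyGraph n).Adj α β) :
    ∃ (i : Fin n) (s : ℤˣ), β.shift = α.shift + Pi.single i (s : ℤ) := by
  obtain ⟨i, rfl | rfl⟩ := adj_iff.1 h
  · exact ⟨i, 1, by simp [shift_t_mul]⟩
  · exact ⟨i, -1, by simp [shift_t_mul, Pi.single_neg]⟩

theorem eq_t_mul_of_adj (h : (cayleyGraph n).Adj α β)
    (hi : β.shift = α.shift + Pi.single i 1) : β = t i * α := by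
  obtain ⟨j, rfl | rfl⟩ := adj_iff.1 h
  · rw [shift_t_mul, add_right_inj] at hi
    have hij : i = j := by
      by_contra hij
      simpa [hij] using congrFun hi i
    rw [hij]
  · have hj := congrFun hi j
    obtain rfl | hij := eq_or_ne j i
    · simp [shift_t_mul, add_assoc] at hj
    · simp [shift_t_mul, hij] at hj

theorem exists_eq_t_mul_of_common_neighbor (hne : α ≠ β) (hs : α.shift = β.shift)
    (hα : (cayleyGraph n).Adj α γ) (hβ : (cayleyGraph n).Adj β γ) :
    ∃ i, γ = t i * α ∧ γ = t i * β := by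
  obtain ⟨i, h | h⟩ := adj_iff.1 hα
  · exact ⟨i, h, eq_t_mul_of_adj hβ (by rw [← hs, h, shift_t_mul])⟩
  · have hβ' := eq_t_mul_of_adj hβ.symm (i := i) (by rw [← hs, h, shift_t_mul])
    exact absurd (h.trans hβ'.symm) hne

theorem common_neighbor_unique (hne : α ≠ β) (hs : α.shift = β.shift)
    (hαγ : (cayleyGraph n).Adj α γ) (hβγ : (cayleyGraph n).Adj β γ)
    (hαδ : (cayleyGraph n).Adj α δ) (hβδ : (cayleyGraph n).Adj β δ) : γ = δ := by
  obtain ⟨i, hi, hi'⟩ := exists_eq_t_mul_of_common_neighbor hne hs hαγ hβγ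
  obtain ⟨j, hj, hj'⟩ := exists_eq_t_mul_of_common_neighbor hne hs hαδ hβδ
  obtain rfl | hij := eq_or_ne i j
  · exact hi.trans hj.symm
  · exact absurd (eq_of_t_mul_eq hij (hi.symm.trans hi') (hj.symm.trans hj')) hne

theorem shift_square (hαβ : (cayleyGraph n).Adj α β)
    (hαγ : (cayleyGraph n).Adj α γ) (hβδ : (cayleyGraph n).Adj β δ)
    (hγδ : (cayleyGraph n).Adj γ δ) (hαδ : α ≠ δ) (hβγ : β ≠ γ)
    {p r : ℤˣ} (hβ : β.shift = α.shift + Pi.single i (p : ℤ))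
    (hγ : γ.shift = α.shift + Pi.single j (r : ℤ)) :
    i ≠ j ∧ δ.shift = β.shift + Pi.single j (r : ℤ) := by
  obtain ⟨k, q, hq⟩ := exists_shift_eq_of_adj hβδ
  obtain ⟨l, s, hs⟩ := exists_shift_eq_of_adj hγδ
  rw [hq, add_right_inj]
  refine single_eq_single_of_add_eq_add (p := p) (l := l) (s := s) ?_ (fun h => hαδ ?_)
    (fun h => hβγ ?_)
  · rw [← add_right_inj α.shift, ← add_assoc, ← add_assoc, ← hβ, ← hγ, ← hq, hs]
  · exact common_neighbor_unique hβγ (by rw [hβ, hγ, h]) hαβ.symm hαγ.symm hβδ hγδ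
  · exact common_neighbor_unique hαδ (by rw [hq, hβ, add_assoc, h, add_zero]) hαβ hβδ.symm hαγ
      hγδ.symm

end HoughtonMonoid

/-! ### Cubes in the Cayley graph -/

theorem cubeGraph_adj_iff {k : ℕ} {u v : Fin k → ℤˣ} :
    (cubeGraph k).Adj u v ↔ ∃ a, v = Function.update u a (-u a) := by
  change hammingDist u v = 1 ↔ _
  rw [hammingDist, Finset.card_eq_one]
  refine exists_congr fun a => ⟨fun h => funext fun b => ?_, ?_⟩
  · have hb : u b ≠ v b ↔ b = a := by simpa using Finset.ext_iff.1 h b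
    obtain rfl | hba := eq_or_ne b a
    · rw [Function.update_self]
      exact Int.units_ne_iff_eq_neg.1 (hb.2 rfl).symm
    · rw [Function.update_of_ne hba]
      exact (not_not.1 (mt hb.1 hba)).symm
  · rintro rfl
    ext b
    obtain rfl | hba := eq_or_ne b a <;> simp_all [Int.units_ne_iff_eq_neg]

theorem cubeGraph_adj_update {k : ℕ} (u : Fin k → ℤˣ) (a : Fin k) :
    (cubeGraph k).Adj u (Function.update u a (-u a)) :=
  cubeGraph_adj_iff.2 ⟨a, rfl⟩

theorem update_induction {ι : Type*} [Finite ι] [DecidableEq ι] {R : ι → Type*}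
    {P : (∀ a, R a) → Prop} {x y : ∀ a, R a}
    (step : ∀ z a, z a = x a → P z → P (Function.update z a (y a))) (hx : P x) : P y := by
  have := Fintype.ofFinite ι
  have hA (A : Finset ι) : P (A.piecewise y x) := by
    induction A using Finset.induction_on with
    | empty => simpa
    | insert a A ha ih =>
      rw [Finset.piecewise_insert]
      exact step _ a (by simp [ha]) ih
  simpa using hA Finset.univ

/-- The position of the vertex `ε` in the cube with lowest vertex `0` whose edge directions are
given by `ι`: the indicator vector of the image under `ι` of the positive entries of `ε`. -/
noncomputable def cubeVec {k n : ℕ} (ι : Fin k ↪ Fin n) (ε : Fin k → ℤˣ) : Fin n → ℕ :=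
  Function.extend ι (fun a => if ε a = 1 then 1 else 0) 0

section cubeVec

variable {k n : ℕ} (ι : Fin k ↪ Fin n)

theorem cubeVec_apply (ε : Fin k → ℤˣ) (a : Fin k) :
    cubeVec ι ε (ι a) = if ε a = 1 then 1 else 0 := ι.injective.extend_apply _ _ _

theorem cubeVec_of_notMem (ε : Fin k → ℤˣ) {i : Fin n} (hi : i ∉ range ι) : cubeVec ι ε i = 0 :=
  Function.extend_apply' _ _ _ hi

theorem cubeVec_update_one {ε : Fin k → ℤˣ} {a : Fin k} (ha : ε a = -1) :
    cubeVec ι (Function.update ε a 1) = Pi.single (ι a) 1 + cubeVec ι ε := by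
  funext i
  by_cases hi : i ∈ range ι
  · obtain ⟨b, rfl⟩ := hi
    obtain rfl | hb := eq_or_ne b a
    · simp [cubeVec_apply, ha]
    · simp [cubeVec_apply, hb]
  · have hia : i ≠ ι a := fun h => hi ⟨a, h.symm⟩
    simp [cubeVec_of_notMem ι _ hi, hia]

theorem cubeVec_neg_one : cubeVec ι (-1) = 0 := by
  funext i
  by_cases hi : i ∈ range ι
  · obtain ⟨b, rfl⟩ := hi
    simp [cubeVec_apply]
  · exact cubeVec_of_notMem ι _ hi

theorem cubeVec_injective : Function.Injective (cubeVec ι) := by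
  intro ε ε' h
  funext a
  have ha := congrFun h (ι a)
  rw [cubeVec_apply, cubeVec_apply] at ha
  rcases Int.units_eq_one_or (ε a) with hε | hε <;>
    rcases Int.units_eq_one_or (ε' a) with hε' | hε' <;> simp_all

end cubeVec

namespace HoughtonMonoid

variable {k n : ℕ}

theorem adj_cubeVec_vadd_update (α : HoughtonMonoid n) (ι : Fin k ↪ Fin n) (ε : Fin k → ℤˣ)
    (a : Fin k) : (cayleyGraph n).Adj (cubeVec ι ε +ᵥ α)
      (cubeVec ι (Function.update ε a (-ε a)) +ᵥ α) := by
  refine adj_iff.2 ⟨ι a, ?_⟩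
  rcases Int.units_eq_one_or (ε a) with ha | ha
  · right
    rw [t_mul, ← add_vadd, ha, ← cubeVec_update_one ι (by simp), Function.update_idem, ← ha,
      Function.update_eq_self]
  · left
    rw [t_mul, ← add_vadd, ha, neg_neg, cubeVec_update_one ι ha]

/-- The cube with lowest vertex `α` and the directions given by `ι`. -/
noncomputable def cubeAt (α : HoughtonMonoid n) (ι : Fin k ↪ Fin n) :
    SimpleGraph.Copy (cubeGraph k) (cayleyGraph n) where
  toHom := ⟨fun ε => cubeVec ι ε +ᵥ α, fun h => by
    obtain ⟨a, rfl⟩ := cubeGraph_adj_iff.1 h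
    exact adj_cubeVec_vadd_update α ι _ a⟩
  injective' := fun _ _ h => cubeVec_injective ι (vadd_left_injective α h)

@[simp]
theorem cubeAt_apply (α : HoughtonMonoid n) (ι : Fin k ↪ Fin n) (ε : Fin k → ℤˣ) :
    cubeAt α ι ε = cubeVec ι ε +ᵥ α := rfl

section Copy

variable (f : SimpleGraph.Copy (cubeGraph k) (cayleyGraph n))

theorem shift_copy_square {ε : Fin k → ℤˣ} {a b : Fin k} (hab : a ≠ b) {i j : Fin n} {p r : ℤˣ}
    (ha : (f (Function.update ε a (-ε a))).shift = (f ε).shift + Pi.single i (p : ℤ))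
    (hb : (f (Function.update ε b (-ε b))).shift = (f ε).shift + Pi.single j (r : ℤ)) :
    i ≠ j ∧ (f (Function.update (Function.update ε a (-ε a)) b (-ε b))).shift =
      (f (Function.update ε a (-ε a))).shift + Pi.single j (r : ℤ) := by
  have hadj (η : Fin k → ℤˣ) (c : Fin k) := f.toHom.map_adj (cubeGraph_adj_update η c)
  refine shift_square (hadj ε a) (hadj ε b) ?_ ?_ (fun h => ?_) (fun h => ?_) ha hb
  · simpa [hab.symm] using hadj (Function.update ε a (-ε a)) b
  · simpa [hab, Function.update_comm hab.symm] using hadj (Function.update ε b (-ε b)) a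
  · simpa using congrFun (f.injective h) b
  · simpa [hab] using congrFun (f.injective h) a

theorem shift_copy_update {a : Fin k} {i : Fin n} {s : ℤˣ} {ε : Fin k → ℤˣ}
    (h : (f (Function.update ε a 1)).shift =
      (f (Function.update ε a (-1))).shift + Pi.single i (s : ℤ)) (η : Fin k → ℤˣ) :
    (f (Function.update η a 1)).shift =
      (f (Function.update η a (-1))).shift + Pi.single i (s : ℤ) := by
  refine update_induction (P := fun η => (f (Function.update η a 1)).shift =
    (f (Function.update η a (-1))).shift + Pi.single i (s : ℤ)) (fun ε b _ hε => ?_) h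
  obtain rfl | hab := eq_or_ne a b
  · simpa using hε
  obtain hb | hb := eq_or_ne (η b) (ε b)
  · rwa [hb, Function.update_eq_self]
  · obtain ⟨j, r, hj⟩ := exists_shift_eq_of_adj
      (f.toHom.map_adj (cubeGraph_adj_update (Function.update ε a (-1)) b))
    have := (shift_copy_square f (ε := Function.update ε a (-1)) hab.symm hj
      (b := a) (by simpa using hε)).2
    rw [Int.units_ne_iff_eq_neg.1 hb]
    simpa [hab.symm, Function.update_comm hab] using this

theorem exists_directions : ∃ (ι : Fin k ↪ Fin n) (s : Fin k → ℤˣ), ∀ ε a,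
    (f (Function.update ε a 1)).shift =
      (f (Function.update ε a (-1))).shift + Pi.single (ι a) (s a : ℤ) := by
  have hedge (a : Fin k) : ∃ (i : Fin n) (s : ℤˣ),
      (f (Function.update (-1) a 1)).shift = (f (-1)).shift + Pi.single i (s : ℤ) := by
    simpa using exists_shift_eq_of_adj (f.toHom.map_adj (cubeGraph_adj_update (-1) a))
  choose ι s hs using hedge
  have hι : Function.Injective ι := fun a b hab => by
    by_contra hne
    exact (shift_copy_square f (ε := -1) hne (by simpa using hs a) (by simpa using hs b)).1 hab
  refine ⟨⟨ι, hι⟩, s, fun ε a => shift_copy_update f (ε := -1) ?_ ε⟩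
  have hself : Function.update (-1 : Fin k → ℤˣ) a (-1) = -1 := Function.update_eq_self a _
  exact (hs a).trans (by rw [hself]; rfl)

theorem exists_copy_update_eq_t_mul : ∃ (ι : Fin k ↪ Fin n) (s : Fin k → ℤˣ), ∀ ε a,
    ε a = -s a → f (Function.update ε a (s a)) = t (ι a) * f ε := by
  obtain ⟨ι, s, h⟩ := exists_directions f
  refine ⟨ι, s, fun ε a hε => eq_t_mul_of_adj ?_ ?_⟩
  · simpa [hε] using f.toHom.map_adj (cubeGraph_adj_update ε a)
  · have ha := h ε a
    have hself : Function.update ε a (-s a) = ε := by rw [← hε, Function.update_eq_self]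
    change (f (Function.update ε a (s a))).shift = _
    rcases Int.units_eq_one_or (s a) with hs | hs <;> rw [hs] at ha hself ⊢
    · simpa [hself] using ha
    · rw [neg_neg] at hself
      rw [hself] at ha
      simp [ha, Pi.single_neg, add_assoc]

/-- Every cube in the Cayley graph is a reparametrization of one of the cubes `cubeAt α ι`. -/
theorem exists_eq_cubeAt : ∃ (α : HoughtonMonoid n) (ι : Fin k ↪ Fin n) (s : Fin k → ℤˣ),
    ∀ ε, f ε = cubeAt α ι (s * ε) := by
  obtain ⟨ι, s, h⟩ := exists_copy_update_eq_t_mul f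
  have hf (ε : Fin k → ℤˣ) : f (s * ε) = cubeVec ι ε +ᵥ f (-s) := by
    refine update_induction (P := fun ε => f (s * ε) = cubeVec ι ε +ᵥ f (-s)) (x := -1)
      (fun η a ha ih => ?_) (by simp [cubeVec_neg_one])
    rcases Int.units_eq_one_or (ε a) with hε | hε
    · have hs : s * Function.update η a 1 = Function.update (s * η) a (s a) := by
        funext b
        obtain rfl | hb := eq_or_ne b a <;> simp [*]
      rw [hε, cubeVec_update_one ι ha, add_vadd, ← ih, ← t_mul, hs]
      exact h _ a (by simp [ha])
    · rwa [hε, Function.update_eq_self_iff.2 ha.symm]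
  refine ⟨f (-s), ι, s, fun ε => ?_⟩
  rw [cubeAt_apply, ← hf, ← mul_assoc]
  congr
  funext a
  simp

end Copy

end HoughtonMonoid

/-! ### Interpolation of functions on the vertices of a cube -/

/-- The vertex `ε` of the cube as a point of `ℝ^ι`. -/
def signVec {ι : Type*} (ε : ι → ℤˣ) : ι → ℝ := fun a => ((ε a : ℤ) : ℝ)

theorem signVec_eq_or {ι : Type*} (ε : ι → ℤˣ) (a : ι) : signVec ε a = 1 ∨ signVec ε a = -1 := by
  rcases Int.units_eq_one_or (ε a) with h | h <;> simp [signVec, h]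

section faceMap

variable {R : Type} [Mul R] {j k : ℕ} (ι : Fin j ↪ Fin k) (s : Fin j → R) (c : Fin k → R)

theorem faceMap_apply (x : Fin j → R) (a : Fin j) : faceMap ι s c x (ι a) = s a * x a :=
  ι.injective.extend_apply _ _ _

theorem faceMap_of_notMem (x : Fin j → R) {b : Fin k} (hb : b ∉ range ι) :
    faceMap ι s c x b = c b :=
  Function.extend_apply' _ _ _ hb

theorem faceMap_update (x : Fin j → R) (a : Fin j) (u : R) :
    faceMap ι s c (Function.update x a u) = Function.update (faceMap ι s c x) (ι a) (s a * u) := by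
  funext b
  by_cases hb : b ∈ range ι
  · obtain ⟨a', rfl⟩ := hb
    obtain rfl | h := eq_or_ne a' a
    · simp [faceMap_apply]
    · simp [faceMap_apply, h]
  · have hba : b ≠ ι a := fun h => hb ⟨a, h.symm⟩
    simp [faceMap_of_notMem ι s c _ hb, hba]

end faceMap

theorem signVec_faceMap {j k : ℕ} (ι : Fin j ↪ Fin k) (s : Fin j → ℤˣ) (c : Fin k → ℤˣ)
    (ε : Fin j → ℤˣ) :
    signVec (faceMap ι s c ε) = faceMap ι (signVec s) (signVec c) (signVec ε) := by
  funext b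
  by_cases hb : b ∈ range ι
  · obtain ⟨a, rfl⟩ := hb
    simp [signVec, faceMap_apply]
  · simp [signVec, faceMap_of_notMem _ _ _ _ hb]

section Interpolation

variable {ι E : Type*} [DecidableEq ι] [AddCommGroup E] [Module ℝ E]

/-- A function on `ℝ^ι` that is affine in each coordinate, as expressed by its values where this
coordinate is `±1`. -/
def IsMultiAffine (F : (ι → ℝ) → E) : Prop :=
  ∀ x a u, F (Function.update x a u) =
    ((1 + u) / 2) • F (Function.update x a 1) + ((1 - u) / 2) • F (Function.update x a (-1))

theorem IsMultiAffine.eq_of_forall_update {F G : (ι → ℝ) → E} (hF : IsMultiAffine F)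
    (hG : IsMultiAffine G) {x : ι → ℝ} {a : ι}
    (h : ∀ u : ℤˣ, F (Function.update x a (u : ℤ)) = G (Function.update x a (u : ℤ))) :
    F x = G x := by
  have h₁ := h 1
  have h₂ := h (-1)
  simp only [Units.val_neg, Units.val_one, Int.cast_neg, Int.cast_one] at h₁ h₂
  rw [← Function.update_eq_self a x, hF, hG, h₁, h₂]

theorem IsMultiAffine.ext [Finite ι] {F G : (ι → ℝ) → E} (hF : IsMultiAffine F)
    (hG : IsMultiAffine G) (h : ∀ ε, F (signVec ε) = G (signVec ε)) : F = G := by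
  have := Fintype.ofFinite ι
  have hA (A : Finset ι) : ∀ x : ι → ℝ, (∀ a ∉ A, ∃ u : ℤˣ, x a = (u : ℤ)) → F x = G x := by
    induction A using Finset.induction_on with
    | empty =>
      intro x hx
      choose ε hε using fun a => hx a (Finset.notMem_empty a)
      rw [show x = signVec ε from funext hε, h]
    | insert a A ha ih =>
      refine fun x hx => hF.eq_of_forall_update hG (a := a) fun u => ih _ fun b hb => ?_
      obtain rfl | hba := eq_or_ne b a
      · exact ⟨u, Function.update_self ..⟩
      · rw [Function.update_of_ne hba]
        exact hx b (by simp [hba, hb])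
  exact funext fun x => hA Finset.univ x fun a ha => absurd (Finset.mem_univ a) ha

variable [Fintype ι]

/-- The weight of the vertex `ε` of the cube at the point `x`, that is, the function affine in each
coordinate that is `1` at `ε` and `0` at the other vertices. -/
noncomputable def vertexWeight (ε : ι → ℤˣ) (x : ι → ℝ) : ℝ := ∏ a, (1 + signVec ε a * x a) / 2

/-- The extension of a function on the vertices of the cube that is affine in each coordinate. -/
noncomputable def interp (φ : (ι → ℤˣ) → E) (x : ι → ℝ) : E := ∑ ε, vertexWeight ε x • φ ε

theorem continuous_vertexWeight {ι : Type*} [Fintype ι] (ε : ι → ℤˣ) :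
    Continuous (vertexWeight ε) := by
  unfold vertexWeight
  fun_prop

theorem continuous_interp [TopologicalSpace E] [IsTopologicalAddGroup E] [ContinuousSMul ℝ E]
    (φ : (ι → ℤˣ) → E) : Continuous (interp φ) :=
  continuous_finsetSum _ fun ε _ => (continuous_vertexWeight ε).smul continuous_const

theorem vertexWeight_update (ε : ι → ℤˣ) (x : ι → ℝ) (a : ι) (u : ℝ) :
    vertexWeight ε (Function.update x a u) =
      (1 + signVec ε a * u) / 2 * ∏ b ∈ Finset.univ.erase a, (1 + signVec ε b * x b) / 2 := by
  rw [vertexWeight, ← Finset.mul_prod_erase _ _ (Finset.mem_univ a), Function.update_self]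
  congr 1
  refine Finset.prod_congr rfl fun b hb => ?_
  rw [Function.update_of_ne (Finset.ne_of_mem_erase hb)]

theorem isMultiAffine_interp (φ : (ι → ℤˣ) → E) : IsMultiAffine (interp φ) := by
  intro x a u
  simp only [interp, Finset.smul_sum, ← Finset.sum_add_distrib, vertexWeight_update]
  exact Finset.sum_congr rfl fun ε _ => by module

theorem vertexWeight_signVec {ι : Type*} [Fintype ι] (ε η : ι → ℤˣ) :
    vertexWeight ε (signVec η) = if ε = η then 1 else 0 := by
  split_ifs with h
  · subst h
    refine Finset.prod_eq_one fun a _ => ?_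
    rcases signVec_eq_or ε a with h | h <;> norm_num [h]
  · obtain ⟨a, ha⟩ := Function.ne_iff.1 h
    refine Finset.prod_eq_zero (Finset.mem_univ a) ?_
    rw [signVec, signVec, Int.units_ne_iff_eq_neg.1 ha]
    rcases Int.units_eq_one_or (η a) with h | h <;> simp [h]

theorem interp_signVec (φ : (ι → ℤˣ) → E) (ε : ι → ℤˣ) : interp φ (signVec ε) = φ ε := by
  simp [interp, vertexWeight_signVec]

theorem interp_eq_of_isMultiAffine {F : (ι → ℝ) → E} (hF : IsMultiAffine F)
    {φ : (ι → ℤˣ) → E} (h : ∀ ε, φ ε = F (signVec ε)) : interp φ = F :=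
  (isMultiAffine_interp φ).ext hF fun ε => by rw [interp_signVec, h]

theorem IsMultiAffine.comp_faceMap {j k : ℕ} {F : (Fin k → ℝ) → E} (hF : IsMultiAffine F)
    (ι : Fin j ↪ Fin k) (s : Fin j → ℤˣ) (c : Fin k → ℝ) :
    IsMultiAffine fun x => F (faceMap ι (signVec s) c x) := by
  intro x a u
  simp only [faceMap_update]
  rw [hF]
  rcases signVec_eq_or s a with hs | hs <;> simp only [hs, one_mul, mul_neg, mul_one, neg_mul,
    neg_neg]
  module

theorem interp_faceMap {j k : ℕ} (ι : Fin j ↪ Fin k) (s : Fin j → ℤˣ) (c : Fin k → ℤˣ)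
    (φ : (Fin k → ℤˣ) → E) (x : Fin j → ℝ) :
    interp (fun ε => φ (faceMap ι s c ε)) x =
      interp φ (faceMap ι (signVec s) (signVec c) x) :=
  congrFun (interp_eq_of_isMultiAffine ((isMultiAffine_interp φ).comp_faceMap ι s _) fun ε => by
    rw [← signVec_faceMap, interp_signVec]) x

end Interpolation

namespace CubeFilling

variable {V : Type} {G : SimpleGraph V}

theorem continuous_charMap (f : ParamCube G) : Continuous (charMap f) :=
  continuous_quot_mk.comp continuous_sigmaMk

theorem isOpen_iff {U : Set (CubeFilling G)} :
    IsOpen U ↔ ∀ f : ParamCube G, IsOpen (charMap f ⁻¹' U) :=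
  isOpen_coinduced.trans isOpen_sigma_iff

variable {E : Type*} [AddCommGroup E] [Module ℝ E]

/-- The extension of a function on the vertices of a cube complex that is affine in each coordinate
of each cube. -/
noncomputable def extend (g : V → E) : CubeFilling G → E :=
  Quot.lift (fun p => interp (fun ε => g (p.1.2 ε)) (p.2 : Fin p.1.1 → ℝ)) (by
    rintro p q ⟨ι, s, c, hvert, hpt⟩
    simp only [hvert]
    rw [hpt]
    exact interp_faceMap ι s c (fun ε => g (q.1.2 ε)) _)

theorem extend_charMap (g : V → E) (f : ParamCube G) (x : SolidCube f.1) :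
    extend g (charMap f x) = interp (fun ε => g (f.2 ε)) x := rfl

theorem continuous_extend [TopologicalSpace E] [IsTopologicalAddGroup E] [ContinuousSMul ℝ E]
    (g : V → E) : Continuous (extend g : CubeFilling G → E) :=
  continuous_quot_lift _ (continuous_sigma fun f =>
    (continuous_interp fun ε => g (f.2 ε)).comp continuous_subtype_val)

end CubeFilling

/-! ### Coordinates on cubes -/

theorem mem_closedBall_pi_iff {k : ℕ} {x : Fin k → ℝ} :
    x ∈ closedBall (0 : Fin k → ℝ) 1 ↔ ∀ a, -1 ≤ x a ∧ x a ≤ 1 := by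
  simp [pi_norm_le_iff_of_nonneg, abs_le]

theorem mem_ball_pi_iff {k : ℕ} {x : Fin k → ℝ} :
    x ∈ ball (0 : Fin k → ℝ) 1 ↔ ∀ a, -1 < x a ∧ x a < 1 := by
  simp [pi_norm_lt_iff, abs_lt]

theorem exists_eq_of_mem_sphere {k : ℕ} {x : Fin k → ℝ} (hx : x ∈ sphere (0 : Fin k → ℝ) 1) :
    ∃ a, x a = 1 ∨ x a = -1 := by
  by_contra! h
  have hle := mem_closedBall_pi_iff.1 (sphere_subset_closedBall hx)
  have hball : x ∈ ball (0 : Fin k → ℝ) 1 := mem_ball_pi_iff.2 fun a =>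
    ⟨lt_of_le_of_ne (hle a).1 (h a).2.symm, lt_of_le_of_ne (hle a).2 (h a).1⟩
  exact Set.disjoint_left.1 sphere_disjoint_ball hx hball

theorem signVec_mul_mem_closedBall {k : ℕ} (s : Fin k → ℤˣ) {x : Fin k → ℝ}
    (hx : x ∈ closedBall (0 : Fin k → ℝ) 1) : signVec s * x ∈ closedBall (0 : Fin k → ℝ) 1 := by
  refine mem_closedBall_pi_iff.2 fun a => ?_
  have ha := mem_closedBall_pi_iff.1 hx a
  rw [Pi.mul_apply]
  rcases signVec_eq_or s a with h | h <;> rw [h] <;> constructor <;> linarith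

/-- The nearest point of the solid cube. -/
noncomputable def clamp {k : ℕ} (x : Fin k → ℝ) : SolidCube k :=
  ⟨fun a => max (-1) (min 1 (x a)), mem_closedBall_pi_iff.2 fun a => by simp⟩

theorem continuous_clamp {k : ℕ} : Continuous (clamp : (Fin k → ℝ) → SolidCube k) :=
  Continuous.subtype_mk (by fun_prop) _

theorem coe_clamp {k : ℕ} {x : Fin k → ℝ} (hx : x ∈ closedBall (0 : Fin k → ℝ) 1) :
    (clamp x : Fin k → ℝ) = x :=
  funext fun a => by simp [clamp, mem_closedBall_pi_iff.1 hx a]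

section cellVec

variable {k n : ℕ} {F : Type*} [FunLike F (Fin k) (Fin n)]

/-- The position in `ℝⁿ` of the point `x` of the cube with lowest vertex `0` and directions `ι`. -/
noncomputable def cellVec (ι : F) (x : Fin k → ℝ) : Fin n → ℝ :=
  Function.extend ι (fun a => (1 + x a) / 2) 0

theorem cellVec_of_notMem (ι : F) (x : Fin k → ℝ) {i : Fin n} (hi : i ∉ range ι) :
    cellVec ι x i = 0 :=
  Function.extend_apply' _ _ _ hi

variable [EmbeddingLike F (Fin k) (Fin n)] (ι : F)

theorem cellVec_apply (x : Fin k → ℝ) (a : Fin k) : cellVec ι x (ι a) = (1 + x a) / 2 :=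
  (EmbeddingLike.injective ι).extend_apply _ _ _

theorem cellVec_mem_Icc {x : Fin k → ℝ} (hx : x ∈ closedBall (0 : Fin k → ℝ) 1) (i : Fin n) :
    0 ≤ cellVec ι x i ∧ cellVec ι x i ≤ 1 := by
  by_cases hi : i ∈ range ι
  · obtain ⟨a, rfl⟩ := hi
    rw [cellVec_apply]
    constructor <;> linarith [mem_closedBall_pi_iff.1 hx a]
  · simp [cellVec_of_notMem ι x hi]

theorem cellVec_mem_Ico {x : Fin k → ℝ} (hx : x ∈ ball (0 : Fin k → ℝ) 1) (i : Fin n) :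
    0 ≤ cellVec ι x i ∧ cellVec ι x i < 1 := by
  by_cases hi : i ∈ range ι
  · obtain ⟨a, rfl⟩ := hi
    rw [cellVec_apply]
    constructor <;> linarith [mem_ball_pi_iff.1 hx a]
  · simp [cellVec_of_notMem ι x hi]

theorem continuous_cellVec : Continuous (cellVec ι) := by
  refine continuous_pi fun i => ?_
  by_cases hi : i ∈ range ι
  · obtain ⟨a, rfl⟩ := hi
    simp only [cellVec_apply]
    fun_prop
  · simp only [cellVec_of_notMem ι _ hi]
    fun_prop

theorem support_cellVec {x : Fin k → ℝ} (hx : x ∈ ball (0 : Fin k → ℝ) 1) :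
    Function.support (cellVec ι x) = range ι := by
  ext i
  by_cases hi : i ∈ range ι
  · refine iff_of_true ?_ hi
    obtain ⟨a, rfl⟩ := hi
    rw [Function.mem_support, cellVec_apply]
    linarith [mem_ball_pi_iff.1 hx a]
  · exact iff_of_false (by simp [cellVec_of_notMem ι x hi]) hi

theorem cellVec_two_mul_sub_one {v : Fin n → ℝ} (hv : Function.support v ⊆ range ι) :
    cellVec ι (fun a => 2 * v (ι a) - 1) = v := by
  funext i
  by_cases hi : i ∈ range ι
  · obtain ⟨a, rfl⟩ := hi
    rw [cellVec_apply]
    ring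
  · rw [cellVec_of_notMem ι _ hi, Function.notMem_support.1 fun h => hi (hv h)]

end cellVec

theorem exists_orderEmbedding_range_eq {n : ℕ} (D : Set (Fin n)) :
    ∃ (k : ℕ) (ι : Fin k ↪o Fin n), range ι = D := by
  classical
  exact ⟨_, D.toFinset.orderEmbOfFin rfl, by simp⟩

theorem exists_cellVec_eq {n : ℕ} {v : Fin n → ℝ} (hv : ∀ i, 0 ≤ v i ∧ v i < 1) :
    ∃ (k : ℕ) (ι : Fin k ↪o Fin n), ∃ x ∈ ball (0 : Fin k → ℝ) 1, cellVec ι x = v := by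
  obtain ⟨k, ι, hι⟩ := exists_orderEmbedding_range_eq (Function.support v)
  refine ⟨k, ι, _, mem_ball_pi_iff.2 fun a => ?_, cellVec_two_mul_sub_one ι hι.ge⟩
  have hne : v (ι a) ≠ 0 := hι.le (mem_range_self a)
  have hpos := lt_of_le_of_ne (hv (ι a)).1 hne.symm
  constructor <;> linarith [hv (ι a)]

theorem natFloor_max_zero (x : ℝ) : ⌊max x 0⌋₊ = ⌊x⌋₊ := by
  rcases le_total x 0 with h | h <;> simp [h, Nat.floor_of_nonpos]

theorem natFloor_add_fract_max (x : ℝ) : (⌊x⌋₊ : ℝ) + Int.fract (max x 0) = max x 0 := by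
  rw [← natFloor_max_zero, natCast_floor_eq_intCast_floor (le_max_right x 0),
    Int.floor_add_fract]

theorem fract_mem_Ico (x : ℝ) : 0 ≤ Int.fract x ∧ Int.fract x < 1 :=
  ⟨Int.fract_nonneg x, Int.fract_lt_one x⟩

theorem natFloor_eq_zero_of_fract_ne_zero {x : ℝ} (hx : x ≤ 1) (h : Int.fract x ≠ 0) :
    ⌊x⌋₊ = 0 :=
  Nat.floor_eq_zero.2 (lt_of_le_of_ne hx fun h1 => h (by simp [h1]))

section Face

variable {j n : ℕ} (κ : Fin j ↪ Fin n) {a : Fin n → ℕ}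

theorem cubeVec_refl (ε : Fin n → ℤˣ) (i : Fin n) :
    cubeVec (Function.Embedding.refl _) ε i = if ε i = 1 then 1 else 0 :=
  cubeVec_apply (Function.Embedding.refl _) ε i

theorem cubeVec_refl_faceMap (ha : ∀ i, a i ≤ 1) (hκ : ∀ b, a (κ b) = 0) (ε : Fin j → ℤˣ) :
    cubeVec (Function.Embedding.refl _) (faceMap κ 1 (fun i => if a i = 1 then 1 else -1) ε) =
      cubeVec κ ε + a := by
  funext i
  rw [cubeVec_refl, Pi.add_apply]
  by_cases hi : i ∈ range κ
  · obtain ⟨b, rfl⟩ := hi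
    simp [faceMap_apply, cubeVec_apply, hκ]
  · rw [cubeVec_of_notMem κ ε hi, faceMap_of_notMem _ _ _ _ hi]
    obtain h | h := Nat.le_one_iff_eq_zero_or_eq_one.1 (ha i) <;> simp [h]

theorem two_mul_cellVec_add_sub_one (ha : ∀ i, a i ≤ 1) (hκ : ∀ b, a (κ b) = 0)
    (z : Fin j → ℝ) (i : Fin n) :
    2 * (cellVec κ z i + a i) - 1 =
      faceMap κ (signVec 1) (signVec fun i => if a i = 1 then 1 else -1) z i := by
  by_cases hi : i ∈ range κ
  · obtain ⟨b, rfl⟩ := hi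
    simp only [cellVec_apply, hκ, faceMap_apply, signVec, Pi.one_apply]
    push_cast
    ring
  · rw [cellVec_of_notMem κ z hi, faceMap_of_notMem _ _ _ _ hi]
    obtain h | h := Nat.le_one_iff_eq_zero_or_eq_one.1 (ha i) <;> norm_num [h, signVec]

end Face

/-! ### Points of the complex -/

namespace HoughtonComplex

open HoughtonMonoid CubeFilling

variable {n : ℕ}

/-- The point at position `w ∈ [0, 1]ⁿ` in the `n`-cube with lowest vertex `β`. -/
noncomputable def corner (β : HoughtonMonoid n) (w : Fin n → ℝ) : HoughtonComplex n :=
  charMap ⟨n, cubeAt β (Function.Embedding.refl _)⟩ (clamp fun i => 2 * w i - 1)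

/-- The point at position `v ∈ [0, ∞)ⁿ` in the orthant with lowest vertex `α`. Negative
coordinates of `v` are replaced by `0`. -/
noncomputable def pt (α : HoughtonMonoid n) (v : Fin n → ℝ) : HoughtonComplex n :=
  corner ((fun i => ⌊v i⌋₊) +ᵥ α) (fun i => Int.fract (max (v i) 0))

theorem continuous_corner (β : HoughtonMonoid n) : Continuous (corner β) :=
  (continuous_charMap _).comp (continuous_clamp.comp (by fun_prop))

theorem charMap_cubeAt_vadd {j : ℕ} (κ : Fin j ↪ Fin n) {a : Fin n → ℕ} (ha : ∀ i, a i ≤ 1)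
    (hκ : ∀ b, a (κ b) = 0) (β : HoughtonMonoid n) (z : SolidCube j) :
    charMap ⟨j, cubeAt (a +ᵥ β) κ⟩ z = corner β fun i => cellVec κ z i + a i := by
  refine Quot.sound ⟨κ, 1, fun i => if a i = 1 then 1 else -1, fun ε => ?_, ?_⟩
  · change cubeVec κ ε +ᵥ (a +ᵥ β) = cubeVec (Function.Embedding.refl (Fin n)) _ +ᵥ β
    rw [cubeVec_refl_faceMap κ ha hκ, add_vadd]
  · refine (coe_clamp (mem_closedBall_pi_iff.2 fun i => ?_)).trans
      (funext (two_mul_cellVec_add_sub_one κ ha hκ z))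
    by_cases hi : i ∈ range κ
    · obtain ⟨b, rfl⟩ := hi
      have := cellVec_mem_Icc κ z.2 (κ b)
      simp only [hκ, Nat.cast_zero]
      constructor <;> linarith
    · have : (a i : ℝ) ≤ 1 := mod_cast ha i
      simp only [cellVec_of_notMem κ _ hi]
      constructor <;> linarith [(a i).cast_nonneg (α := ℝ)]

theorem charMap_cubeAt_eq_corner {k : ℕ} (β : HoughtonMonoid n) (ι : Fin k ↪ Fin n)
    (x : SolidCube k) : charMap ⟨k, cubeAt β ι⟩ x = corner β (cellVec ι x) := by
  have h := charMap_cubeAt_vadd ι (a := 0) (fun _ => zero_le_one) (fun _ => rfl) β x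
  rw [zero_vadd] at h
  simpa using h

theorem corner_eq_pt (β : HoughtonMonoid n) {w : Fin n → ℝ} (hw : ∀ i, 0 ≤ w i ∧ w i ≤ 1) :
    corner β w = pt β w := by
  obtain ⟨k, κ, z, hz, hfract⟩ := exists_cellVec_eq fun i => fract_mem_Ico (w i)
  have hκ (b : Fin k) : ⌊w (κ b)⌋₊ = 0 := by
    have hb : κ b ∈ Function.support (cellVec κ z) := by
      rw [support_cellVec κ hz]
      exact mem_range_self b
    rw [hfract] at hb
    exact natFloor_eq_zero_of_fract_ne_zero (hw _).2 hb
  have hface := charMap_cubeAt_vadd κ.toEmbedding (a := fun i => ⌊w i⌋₊)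
    (fun i => Nat.floor_le_one_of_le_one (hw i).2) hκ β ⟨z, ball_subset_closedBall hz⟩
  rw [charMap_cubeAt_eq_corner] at hface
  change corner _ (cellVec κ z) = corner β fun i => cellVec κ z i + ⌊w i⌋₊ at hface
  have hmax (i : Fin n) : max (w i) 0 = w i := max_eq_left (hw i).1
  have hadd (i : Fin n) : Int.fract (w i) + ⌊w i⌋₊ = w i := by
    simpa only [hmax, add_comm] using natFloor_add_fract_max (w i)
  simp only [hfract, hadd] at hface
  simp only [pt, hmax, hface]

theorem charMap_cubeAt {k : ℕ} (β : HoughtonMonoid n) (ι : Fin k ↪ Fin n) (x : SolidCube k) :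
    charMap ⟨k, cubeAt β ι⟩ x = pt β (cellVec ι x) :=
  (charMap_cubeAt_eq_corner β ι x).trans (corner_eq_pt β (cellVec_mem_Icc ι x.2))

theorem exists_charMap_eq (f : ParamCube (cayleyGraph n)) :
    ∃ (β : HoughtonMonoid n) (ι : Fin f.1 ↪ Fin n) (s : Fin f.1 → ℤˣ),
      (∀ ε, f.2 ε = cubeAt β ι (s * ε)) ∧
      ∀ x, charMap f x = pt β (cellVec ι (signVec s * (x : Fin f.1 → ℝ))) := by
  obtain ⟨β, ι, s, h⟩ := exists_eq_cubeAt f.2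
  refine ⟨β, ι, s, h, fun x => ?_⟩
  rw [← charMap_cubeAt β ι ⟨_, signVec_mul_mem_closedBall s x.2⟩]
  have hrefl {R : Type} [Mul R] (s c x : Fin f.1 → R) :
      faceMap (Function.Embedding.refl _) s c x = s * x :=
    funext fun a => faceMap_apply (Function.Embedding.refl _) s c x a
  refine Quot.sound ⟨Function.Embedding.refl _, s, 1, fun ε => ?_, (hrefl _ _ _).symm⟩
  rw [hrefl]
  exact h ε

theorem pt_eq_pt_fract (α : HoughtonMonoid n) (v : Fin n → ℝ) :
    pt α v = pt ((fun i => ⌊v i⌋₊) +ᵥ α) (fun i => Int.fract (max (v i) 0)) :=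
  corner_eq_pt _ fun _ => (fract_mem_Ico _).imp_right le_of_lt

theorem pt_max (α : HoughtonMonoid n) (v : Fin n → ℝ) : pt α (fun i => max (v i) 0) = pt α v := by
  simp [pt, natFloor_max_zero]

theorem pt_add (α : HoughtonMonoid n) (a : Fin n → ℕ) {v : Fin n → ℝ} (hv : ∀ i, 0 ≤ v i) :
    pt α (fun i => v i + a i) = pt (a +ᵥ α) v := by
  have hmax (i : Fin n) : max (v i + a i) 0 = max (v i) 0 + a i := by
    rw [max_eq_left (hv i), max_eq_left (add_nonneg (hv i) (Nat.cast_nonneg _))]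
  simp only [pt, hmax, Int.fract_add_natCast, Nat.floor_add_natCast (hv _), ← add_vadd]
  rfl

theorem locallyFinite_unitCubes {ι : Type*} [Finite ι] : LocallyFinite fun a : ι → ℕ =>
    Icc (fun i => (a i : ℝ)) fun i => (a i : ℝ) + 1 := by
  classical
  have := Fintype.ofFinite ι
  intro v
  refine ⟨univ.pi fun i => Iio (v i + 1),
    (isOpen_set_pi finite_univ fun _ _ => isOpen_Iio).mem_nhds fun i _ => lt_add_one (v i), ?_⟩
  refine (Set.finite_Iic fun i => ⌊v i + 1⌋₊).subset ?_
  rintro a ⟨w, hw, hwv⟩ i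
  exact Nat.le_floor ((hw.1 i).trans (hwv i (mem_univ i)).le)

theorem continuous_pt (α : HoughtonMonoid n) : Continuous (pt α) := by
  have hmax : Continuous fun (v : Fin n → ℝ) i => max (v i) 0 := by fun_prop
  refine (locallyFinite_unitCubes.preimage_continuous hmax).continuous ?_
    (fun a => isClosed_Icc.preimage hmax) fun a => ?_
  · refine eq_univ_of_forall fun v => mem_iUnion.2 ⟨fun i => ⌊max (v i) 0⌋₊, ?_⟩
    exact ⟨fun _ => Nat.floor_le (le_max_right _ _), fun _ => (Nat.lt_floor_add_one _).le⟩
  · have hcorner : Continuous fun v : Fin n → ℝ => corner (a +ᵥ α) fun i => max (v i) 0 - a i :=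
      (continuous_corner _).comp (by fun_prop)
    refine hcorner.continuousOn.congr fun v hv => ?_
    have hnonneg (i : Fin n) : 0 ≤ max (v i) 0 - a i := sub_nonneg.2 (hv.1 i)
    have hle (i : Fin n) : max (v i) 0 - a i ≤ 1 := sub_le_iff_le_add'.2 (hv.2 i)
    change pt α v = corner _ _
    rw [corner_eq_pt _ fun i => ⟨hnonneg i, hle i⟩, ← pt_add α a hnonneg, ← pt_max]
    simp only [sub_add_cancel]

theorem exists_pt_eq (z : HoughtonComplex n) :
    ∃ (α : HoughtonMonoid n) (v : Fin n → ℝ), (∀ i, 0 ≤ v i ∧ v i < 1) ∧ pt α v = z := by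
  obtain ⟨f, x⟩ := z
  obtain ⟨β, ι, s, -, h⟩ := exists_charMap_eq f
  exact ⟨_, _, fun i => fract_mem_Ico _, (pt_eq_pt_fract β _).symm.trans (h x).symm⟩

section Extend

variable {E : Type*} [AddCommGroup E] [Module ℝ E]

theorem extend_pt (g : HoughtonMonoid n → E) (α : HoughtonMonoid n) {v : Fin n → ℝ}
    (hv : ∀ i, 0 ≤ v i ∧ v i ≤ 1) :
    CubeFilling.extend g (pt α v) =
      interp (fun ε => g (cubeAt α (Function.Embedding.refl _) ε)) fun i => 2 * v i - 1 := by
  rw [← corner_eq_pt α hv, corner, extend_charMap, coe_clamp]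
  exact mem_closedBall_pi_iff.2 fun i => by constructor <;> linarith [hv i]

end Extend

/-- The position of a point in `ℝⁿ`, which at a vertex is its translation vector. -/
noncomputable def height : HoughtonComplex n → Fin n → ℝ :=
  CubeFilling.extend fun α i => (α.shift i : ℝ)

theorem continuous_height : Continuous (height : HoughtonComplex n → Fin n → ℝ) :=
  continuous_extend _

theorem height_pt_of_le_one (α : HoughtonMonoid n) {v : Fin n → ℝ}
    (hv : ∀ i, 0 ≤ v i ∧ v i ≤ 1) (i : Fin n) : height (pt α v) i = α.shift i + v i := by
  rw [height, extend_pt _ _ hv, interp_eq_of_isMultiAffine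
    (F := fun x i => α.shift i + (1 + x i) / 2)]
  · ring
  · intro x a u
    funext b
    obtain rfl | h := eq_or_ne b a
    · simp
      ring
    · simp [h]
      ring
  · intro ε
    funext b
    rw [cubeAt_apply, shift_vadd, cubeVec_refl]
    rcases Int.units_eq_one_or (ε b) with h | h <;> simp [signVec, h]

theorem height_pt (α : HoughtonMonoid n) (v : Fin n → ℝ) (i : Fin n) :
    height (pt α v) i = α.shift i + max (v i) 0 := by
  rw [pt_eq_pt_fract, height_pt_of_le_one _ fun i => (fract_mem_Ico _).imp_right le_of_lt,
    shift_vadd, Int.cast_add, Int.cast_natCast, add_assoc, natFloor_add_fract_max]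

theorem extend_indicator_pt_pos (α : HoughtonMonoid n) {v : Fin n → ℝ}
    (hv : ∀ i, 0 ≤ v i ∧ v i < 1) :
    0 < CubeFilling.extend (indicator {α} (1 : HoughtonMonoid n → ℝ)) (pt α v) := by
  have hne (ε : Fin n → ℤˣ) (hε : ε ≠ -1) :
      cubeAt α (Function.Embedding.refl _) ε ∉ ({α} : Set (HoughtonMonoid n)) :=
    fun h => hε <| cubeVec_injective _ <| vadd_left_injective α <| by
      simpa [cubeVec_neg_one] using h
  rw [extend_pt _ _ fun i => (hv i).imp_right le_of_lt, interp,
    Finset.sum_eq_single_of_mem (-1) (Finset.mem_univ _) fun ε _ hε => by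
      rw [indicator_of_notMem (hne ε hε), smul_zero]]
  have hweight : 0 < vertexWeight (-1) fun i => 2 * v i - 1 :=
    Finset.prod_pos fun i _ => by
    simp only [signVec, Pi.neg_apply, Pi.one_apply, Units.val_neg, Units.val_one, Int.cast_neg,
      Int.cast_one]
    linarith [hv i]
  simpa [cubeVec_neg_one] using hweight

theorem extend_indicator_pt_eq_zero {α β : HoughtonMonoid n} (hne : α ≠ β)
    (hs : α.shift = β.shift) {v : Fin n → ℝ} (hv : ∀ i, 0 ≤ v i ∧ v i < 1) :
    CubeFilling.extend (indicator {α} (1 : HoughtonMonoid n → ℝ)) (pt β v) = 0 := by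
  rw [extend_pt _ _ fun i => (hv i).imp_right le_of_lt]
  refine Finset.sum_eq_zero fun ε _ => ?_
  dsimp only
  rw [indicator_of_notMem, smul_zero]
  intro (h : cubeVec (Function.Embedding.refl (Fin n)) ε +ᵥ β = α)
  have hzero : cubeVec (Function.Embedding.refl (Fin n)) ε = 0 := by
    funext i
    have := congrArg (fun γ => HoughtonMonoid.shift γ i) h
    simpa only [shift_vadd, hs, add_eq_left, Nat.cast_eq_zero, Pi.zero_apply] using this
  rw [hzero, zero_vadd] at h
  exact hne h.symm

theorem eq_of_height_eq {α β : HoughtonMonoid n} {v w : Fin n → ℝ} (hv : ∀ i, 0 ≤ v i ∧ v i < 1)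
    (hw : ∀ i, 0 ≤ w i ∧ w i < 1) (h : height (pt α v) = height (pt β w)) :
    α.shift = β.shift ∧ v = w := by
  have hsum (i : Fin n) : (α.shift i : ℝ) + v i = β.shift i + w i := by
    simpa only [height_pt, max_eq_left (hv i).1, max_eq_left (hw i).1] using congrFun h i
  have hs : α.shift = β.shift := by
    funext i
    have hfloor := congrArg Int.floor (hsum i)
    rwa [Int.floor_intCast_add, Int.floor_intCast_add, Int.floor_eq_zero_iff.2 (hv i),
      Int.floor_eq_zero_iff.2 (hw i), add_zero, add_zero] at hfloor
  exact ⟨hs, funext fun i => by simpa [hs] using hsum i⟩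

theorem pt_injective {α β : HoughtonMonoid n} {v w : Fin n → ℝ} (hv : ∀ i, 0 ≤ v i ∧ v i < 1)
    (hw : ∀ i, 0 ≤ w i ∧ w i < 1) (h : pt α v = pt β w) : α = β ∧ v = w := by
  obtain ⟨hs, rfl⟩ := eq_of_height_eq hv hw (congrArg height h)
  refine ⟨by_contra fun hne => ?_, rfl⟩
  have hpos := extend_indicator_pt_pos α hv
  rw [h, extend_indicator_pt_eq_zero hne hs hv] at hpos
  exact lt_irrefl _ hpos

instance : T2Space (HoughtonComplex n) := by
  refine ⟨fun y z hne => ?_⟩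
  by_cases hyz : height y = height z
  · obtain ⟨α, v, hv, rfl⟩ := exists_pt_eq y
    obtain ⟨β, w, hw, rfl⟩ := exists_pt_eq z
    obtain ⟨hs, rfl⟩ := eq_of_height_eq hv hw hyz
    have hαβ : α ≠ β := fun h => hne (by rw [h])
    refine separated_by_continuous
      (continuous_extend (indicator {α} (1 : HoughtonMonoid n → ℝ))) ?_
    rw [extend_indicator_pt_eq_zero hαβ hs hv]
    exact (extend_indicator_pt_pos α hv).ne'
  · exact separated_by_continuous continuous_height hyz

end HoughtonComplex

/-! ### The cubical structure -/

theorem ncard_range_orderEmbedding {k n : ℕ} (ι : Fin k ↪o Fin n) : (range ι).ncard = k :=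
  (ncard_range_of_injective ι.injective).trans (Nat.card_fin k)

theorem cellVec_insertNth {k n : ℕ} (ι : Fin (k + 1) ↪o Fin n) (a : Fin (k + 1)) (σ : ℤˣ)
    (x : Fin k → ℝ) :
    cellVec ι (Fin.insertNth (α := fun _ => ℝ) a ((σ : ℤ) : ℝ) x) = fun i =>
      cellVec ((Fin.succAboveOrderEmb a).trans ι) x i +
        ((Pi.single (ι a) (if σ = 1 then 1 else 0) : Fin n → ℕ) i : ℝ) := by
  funext i
  set κ := (Fin.succAboveOrderEmb a).trans ι with hκ
  by_cases hi : i ∈ range ι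
  · obtain ⟨b, rfl⟩ := hi
    rw [cellVec_apply]
    rcases Fin.eq_self_or_eq_succAbove a b with rfl | ⟨b, rfl⟩
    · have hb : ι b ∉ range κ := by
        rintro ⟨c, hc⟩
        exact Fin.succAbove_ne b c (ι.injective hc)
      rw [cellVec_of_notMem κ _ hb, Fin.insertNth_apply_same]
      rcases Int.units_eq_one_or σ with rfl | rfl <;> simp
    · have hb : cellVec κ x (ι (a.succAbove b)) = (1 + x b) / 2 := cellVec_apply κ x b
      rw [hb, Fin.insertNth_apply_succAbove]
      simp [Fin.succAbove_ne]
  · have hκi : i ∉ range κ := fun ⟨c, hc⟩ => hi ⟨_, hc⟩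
    have hia : i ≠ ι a := fun h => hi ⟨a, h.symm⟩
    simp [cellVec_of_notMem ι _ hi, cellVec_of_notMem κ _ hκi, hia]

namespace HoughtonComplex

open HoughtonMonoid CubeFilling

variable {n k : ℕ}

/-- A `k`-cell is given by its lowest vertex and the set of its directions. -/
abbrev Cell (n k : ℕ) : Type := HoughtonMonoid n × (Fin k ↪o Fin n)

/-- The characteristic map of a cell. -/
noncomputable def cellMap (c : Cell n k) (x : Fin k → ℝ) : HoughtonComplex n :=
  pt c.1 (cellVec c.2 x)

/-- The closed cube with lowest vertex `c.1` and directions `range c.2`. -/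
noncomputable def closedCell (c : Cell n k) : Set (HoughtonComplex n) := cellMap c '' closedBall 0 1

theorem continuous_cellMap (c : Cell n k) : Continuous (cellMap c) :=
  (continuous_pt _).comp (continuous_cellVec _)

/-- The left inverse of the characteristic map of a cell that is given by the height. -/
noncomputable def cellCoord (c : Cell n k) (z : HoughtonComplex n) (a : Fin k) : ℝ :=
  2 * (height z (c.2 a) - c.1.shift (c.2 a)) - 1

theorem continuous_cellCoord (c : Cell n k) : Continuous (cellCoord c) := by
  have := continuous_height (n := n)
  unfold cellCoord
  fun_prop

theorem cellCoord_cellMap (c : Cell n k) {x : Fin k → ℝ}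
    (hx : x ∈ closedBall (0 : Fin k → ℝ) 1) : cellCoord c (cellMap c x) = x := by
  funext a
  rw [cellCoord, cellMap, height_pt, max_eq_left (cellVec_mem_Icc c.2 hx _).1, cellVec_apply]
  ring

theorem exists_cellMap_eq (α : HoughtonMonoid n) {v : Fin n → ℝ} (hv : ∀ i, 0 ≤ v i ∧ v i < 1) :
    ∃ (k : ℕ) (ι : Fin k ↪o Fin n), ∃ x ∈ ball (0 : Fin k → ℝ) 1,
      range ι = Function.support v ∧ cellMap (α, ι) x = pt α v := by
  obtain ⟨k, ι, x, hx, rfl⟩ := exists_cellVec_eq hv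
  exact ⟨k, ι, x, hx, (support_cellVec ι hx).symm, rfl⟩

theorem iUnion_closedCell :
    ⋃ (k : ℕ) (c : Cell n k), closedCell c = univ := by
  refine eq_univ_of_forall fun z => ?_
  obtain ⟨α, v, hv, rfl⟩ := exists_pt_eq z
  obtain ⟨k, ι, x, hx, -, h⟩ := exists_cellMap_eq α hv
  exact mem_iUnion₂.2 ⟨k, (α, ι), x, ball_subset_closedBall hx, h⟩

theorem cell_eq_of_cellMap_eq {l : ℕ} {c : Cell n k} {d : Cell n l} {x : Fin k → ℝ}
    {y : Fin l → ℝ} (hx : x ∈ ball (0 : Fin k → ℝ) 1) (hy : y ∈ ball (0 : Fin l → ℝ) 1)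
    (h : cellMap c x = cellMap d y) : (⟨k, c⟩ : Σ k, Cell n k) = ⟨l, d⟩ := by
  obtain ⟨α, ι⟩ := c
  obtain ⟨β, κ⟩ := d
  obtain ⟨rfl : α = β, hv⟩ := pt_injective (cellVec_mem_Ico _ hx) (cellVec_mem_Ico _ hy) h
  have hrange : range ι = range κ := by
    rw [← support_cellVec ι hx, ← support_cellVec κ hy]
    exact congrArg Function.support hv
  obtain rfl : k = l := by
    rw [← ncard_range_orderEmbedding ι, hrange, ncard_range_orderEmbedding]
  rw [OrderEmbedding.range_inj.1 hrange]

theorem exists_cellMap_eq_of_mem_sphere (α : HoughtonMonoid n) (ι : Fin k ↪o Fin n)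
    {x : Fin k → ℝ} (hx : x ∈ sphere (0 : Fin k → ℝ) 1) :
    ∃ m < k, ∃ a ≤ (1 : Fin n → ℕ), ∃ κ : Fin m ↪o Fin n, ∃ y ∈ ball (0 : Fin m → ℝ) 1,
      cellMap (a +ᵥ α, κ) y = cellMap (α, ι) x := by
  have hw := cellVec_mem_Icc ι (sphere_subset_closedBall hx)
  set w := cellVec ι x with hw_def
  obtain ⟨m, κ, y, hy, hκ, h⟩ := exists_cellMap_eq ((fun i => ⌊w i⌋₊) +ᵥ α)
    fun i => fract_mem_Ico (max (w i) 0)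
  rw [← pt_eq_pt_fract] at h
  refine ⟨m, ?_, _, fun i => Nat.floor_le_one_of_le_one (hw i).2, κ, y, hy, h⟩
  have hsub : range κ ⊆ range ι := by
    rw [hκ]
    intro i hi
    by_contra hiι
    exact hi (by simp [hw_def, cellVec_of_notMem ι x hiι])
  obtain ⟨b, hb⟩ := exists_eq_of_mem_sphere hx
  have hbκ : ι b ∉ range κ := by
    rw [hκ, Function.notMem_support, hw_def, cellVec_apply]
    rcases hb with hb | hb <;> simp [hb]
  have hlt := ncard_lt_ncard (ssubset_of_subset_of_ne hsub fun h => hbκ (h ▸ mem_range_self b))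
  rwa [ncard_range_orderEmbedding, ncard_range_orderEmbedding] at hlt

theorem exists_mapsTo_cellMap_sphere (c : Cell n k) : ∃ I : Π m, Finset (Cell n m),
    MapsTo (cellMap c) (sphere 0 1) (⋃ (m < k) (j ∈ I m), closedCell j) := by
  classical
  refine ⟨fun m => (Finset.Iic (1 : Fin n → ℕ) ×ˢ Finset.univ).image fun p => (p.1 +ᵥ c.1, p.2),
    fun x hx => ?_⟩
  obtain ⟨m, hm, a, ha, κ, y, hy, h⟩ := exists_cellMap_eq_of_mem_sphere c.1 c.2 hx
  simp only [mem_iUnion]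
  exact ⟨m, hm, (a +ᵥ c.1, κ), Finset.mem_image.2 ⟨(a, κ), by simpa using ha, rfl⟩, y,
    ball_subset_closedBall hy, h⟩

theorem cellMap_insertNth (α : HoughtonMonoid n) (ι : Fin (k + 1) ↪o Fin n) (a : Fin (k + 1))
    (σ : ℤˣ) {x : Fin k → ℝ} (hx : x ∈ closedBall (0 : Fin k → ℝ) 1) :
    cellMap (α, ι) (Fin.insertNth (α := fun _ => ℝ) a ((σ : ℤ) : ℝ) x) =
      cellMap ((Pi.single (ι a) (if σ = 1 then 1 else 0) : Fin n → ℕ) +ᵥ α,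
        (Fin.succAboveOrderEmb a).trans ι) x := by
  rw [cellMap, cellMap, ← pt_add _ _ fun i => (cellVec_mem_Icc _ hx i).1, cellVec_insertNth]

theorem pt_mem_closedCell {c : Cell n k} {v : Fin n → ℝ} (hv : ∀ i, 0 ≤ v i ∧ v i ≤ 1)
    (hs : Function.support v ⊆ range c.2) : pt c.1 v ∈ closedCell c := by
  refine ⟨fun a => 2 * v (c.2 a) - 1, mem_closedBall_pi_iff.2 fun a => ?_, ?_⟩
  · constructor <;> linarith [hv (c.2 a)]
  · rw [cellMap, cellVec_two_mul_sub_one c.2 hs]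

theorem isClosed_of_inter_closedCell {A : Set (HoughtonComplex n)}
    (hA : ∀ c : Cell n n, IsClosed (A ∩ closedCell c)) : IsClosed A := by
  rw [← isOpen_compl_iff, isOpen_iff]
  intro f
  obtain ⟨β, ι, s, -, h⟩ := exists_charMap_eq f
  have hpre : charMap f ⁻¹' Aᶜ = (charMap f ⁻¹'
      (A ∩ closedCell ((β, RelEmbedding.refl _) : Cell n n)))ᶜ := by
    rw [preimage_compl, preimage_inter, inter_eq_left.2]
    intro x _
    rw [mem_preimage, h]
    exact pt_mem_closedCell (cellVec_mem_Icc _ (signVec_mul_mem_closedBall s x.2))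
      fun i _ => ⟨i, rfl⟩
  rw [hpre]
  exact ((hA _).preimage (continuous_charMap f)).isOpen_compl

theorem isEmbedding_domRestrict_cellMap (c : Cell n k) :
    IsEmbedding ((sphere (0 : Fin k → ℝ) 1).domRestrict (cellMap c)) := by
  refine .of_comp ((continuous_cellMap c).comp continuous_subtype_val) (continuous_cellCoord c) ?_
  convert IsEmbedding.subtypeVal using 1
  exact funext fun x => cellCoord_cellMap c (sphere_subset_closedBall x.2)

/-- The characteristic map of a cell as a bijection from the open cube onto the open cell. -/
noncomputable def cellEquiv (c : Cell n k) : PartialEquiv (Fin k → ℝ) (HoughtonComplex n) where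
  toFun := cellMap c
  invFun := cellCoord c
  source := ball 0 1
  target := cellMap c '' ball 0 1
  map_source' _ hx := mem_image_of_mem _ hx
  map_target' := by
    rintro _ ⟨x, hx, rfl⟩
    rwa [cellCoord_cellMap c (ball_subset_closedBall hx)]
  left_inv' _ hx := cellCoord_cellMap c (ball_subset_closedBall hx)
  right_inv' := by
    rintro _ ⟨x, hx, rfl⟩
    rw [cellCoord_cellMap c (ball_subset_closedBall hx)]

/-- The cubical structure of `Xₙ`. -/
noncomputable def cubicalComplex (n : ℕ) : CubicalComplex (HoughtonComplex n) where
  cell := Cell n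
  map _ := cellEquiv
  source_eq _ _ := rfl
  continuousOn _ c := (continuous_cellMap c).continuousOn
  continuousOn_symm _ c := (continuous_cellCoord c).continuousOn
  pairwiseDisjoint' := by
    rintro ⟨k, c⟩ - ⟨l, d⟩ - hne
    refine Set.disjoint_left.2 ?_
    rintro _ ⟨x, hx, rfl⟩ ⟨y, hy, h⟩
    exact hne (cell_eq_of_cellMap_eq hx hy h.symm)
  mapsTo' _ := exists_mapsTo_cellMap_sphere
  closed' _ _ hA := isClosed_of_inter_closedCell fun c => hA _ c
  union' := iUnion_closedCell
  t2Space := inferInstance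
  exists_facet _ c a σ :=
    ⟨_, LinearIsometryEquiv.refl ℝ _, fun _ hx => cellMap_insertNth c.1 c.2 a σ hx⟩
  isEmbedding_attach _ := isEmbedding_domRestrict_cellMap

end HoughtonComplex

/-! ### Cells and copies of cubes -/

theorem verts_toSubgraph {V W : Type*} {G : SimpleGraph V} {H : SimpleGraph W}
    (f : SimpleGraph.Copy G H) : f.toSubgraph.verts = range f :=
  image_univ

theorem toSubgraph_eq_of_iso {V W : Type*} {G : SimpleGraph V} {H : SimpleGraph W}
    {f g : SimpleGraph.Copy G H} (σ : G ≃g G) (h : ∀ v, f v = g (σ v)) :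
    f.toSubgraph = g.toSubgraph := by
  have hfg : f.toHom = g.toHom.comp σ.toHom := RelHom.ext h
  rw [SimpleGraph.Copy.toSubgraph, SimpleGraph.Copy.toSubgraph, hfg, SimpleGraph.Subgraph.map_comp,
    SimpleGraph.Subgraph.map_iso_top]

/-- The symmetry of the cube given by sign changes followed by a permutation of the coordinates. -/
def cubeIso {k : ℕ} (π : Equiv.Perm (Fin k)) (s : Fin k → ℤˣ) : cubeGraph k ≃g cubeGraph k where
  toEquiv := (Equiv.mulLeft s).trans (π.symm.arrowCongr (Equiv.refl _))
  map_rel_iff' {u v} :=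
    Eq.congr_left (Finset.card_equiv π fun a => by simp : hammingDist _ _ = hammingDist u v)

theorem cubeIso_apply {k : ℕ} (π : Equiv.Perm (Fin k)) (s ε : Fin k → ℤˣ) :
    cubeIso π s ε = (s * ε) ∘ π := rfl

theorem cubeVec_comp_perm {k n : ℕ} {ι κ : Fin k ↪ Fin n} {π : Equiv.Perm (Fin k)}
    (h : ∀ a, κ a = ι (π a)) (ε : Fin k → ℤˣ) : cubeVec κ (ε ∘ π) = cubeVec ι ε := by
  funext i
  by_cases hi : i ∈ range κ
  · obtain ⟨a, rfl⟩ := hi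
    rw [cubeVec_apply, h, cubeVec_apply]
    rfl
  · have hι : i ∉ range ι := fun ⟨b, hb⟩ => hi ⟨π.symm b, by rw [h, π.apply_symm_apply, hb]⟩
    rw [cubeVec_of_notMem κ _ hi, cubeVec_of_notMem ι _ hι]

namespace HoughtonComplex

open HoughtonMonoid CubeFilling

variable {n k : ℕ} {α β : HoughtonMonoid n}

theorem eq_of_mem_range_cubeAt {ι κ : Fin k ↪ Fin n} (hα : α ∈ range (cubeAt β κ))
    (hβ : β ∈ range (cubeAt α ι)) : α = β := by
  obtain ⟨ε, rfl⟩ := hα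
  obtain ⟨η, hη⟩ := hβ
  rw [cubeAt_apply, cubeAt_apply, ← add_vadd] at hη
  have hsum : cubeVec ι η + cubeVec κ ε = 0 :=
    vadd_left_injective β (hη.trans (zero_vadd _ β).symm)
  rw [cubeAt_apply, (add_eq_zero.1 hsum).2, zero_vadd]

theorem range_subset_of_range_cubeAt_subset {ι κ : Fin k ↪ Fin n}
    (h : range (cubeAt α ι) ⊆ range (cubeAt α κ)) : range ι ⊆ range κ := by
  rintro _ ⟨a, rfl⟩
  obtain ⟨ε, hε⟩ := h (mem_range_self 1)
  have hvec : cubeVec κ ε (ι a) = 1 := by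
    rw [vadd_left_injective α hε, cubeVec_apply]
    rfl
  by_contra ha
  simp [cubeVec_of_notMem κ ε ha] at hvec

theorem cubeAt_toSubgraph_injective :
    Function.Injective fun c : Cell n k => (cubeAt c.1 c.2.toEmbedding).toSubgraph := by
  rintro ⟨α, ι⟩ ⟨β, κ⟩ h
  have hrange : range (cubeAt α ι.toEmbedding) = range (cubeAt β κ.toEmbedding) := by
    simpa only [verts_toSubgraph] using congrArg SimpleGraph.Subgraph.verts h
  have hbot (γ : HoughtonMonoid n) (ι : Fin k ↪ Fin n) : γ ∈ range (cubeAt γ ι) :=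
    ⟨-1, by rw [cubeAt_apply, cubeVec_neg_one, zero_vadd]⟩
  obtain rfl := eq_of_mem_range_cubeAt (hrange ▸ hbot α _) (hrange.symm ▸ hbot β _)
  obtain rfl : ι = κ := OrderEmbedding.range_inj.1 <|
    (range_subset_of_range_cubeAt_subset hrange.subset).antisymm
      (range_subset_of_range_cubeAt_subset hrange.superset)
  rfl

theorem exists_cubeAt_toSubgraph_eq (f : SimpleGraph.Copy (cubeGraph k) (cayleyGraph n)) :
    ∃ c : Cell n k, (cubeAt c.1 c.2.toEmbedding).toSubgraph = f.toSubgraph := by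
  obtain ⟨α, ι, s, h⟩ := exists_eq_cubeAt f
  set π := Tuple.sort ι
  let κ : Fin k ↪o Fin n := OrderEmbedding.ofStrictMono (ι ∘ π)
    ((Tuple.monotone_sort ι).strictMono_of_injective (ι.injective.comp π.injective))
  refine ⟨(α, κ), (toSubgraph_eq_of_iso (cubeIso π s) fun ε => ?_).symm⟩
  rw [h, cubeAt_apply, cubeAt_apply, cubeIso_apply, cubeVec_comp_perm fun a => rfl]

theorem isStandard_cubicalComplex (n : ℕ) : IsStandard (cubicalComplex n) := by
  refine fun k => ⟨Equiv.ofBijective (fun c : Cell n k => ⟨(cubeAt c.1 c.2.toEmbedding).toSubgraph,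
    ⟨(cubeAt c.1 c.2.toEmbedding).isoToSubgraph⟩⟩) ⟨fun c d h => ?_, fun ⟨H, hH⟩ => ?_⟩,
    fun c => ⟨cubeAt c.1 c.2.toEmbedding, rfl, fun x => (charMap_cubeAt _ _ x).symm⟩⟩
  · exact cubeAt_toSubgraph_injective (congrArg Subtype.val h)
  · obtain ⟨f, -, rfl⟩ := SimpleGraph.Copy.toSubgraph_surjOn hH
    obtain ⟨c, hc⟩ := exists_cubeAt_toSubgraph_eq f
    exact ⟨c, Subtype.ext hc⟩

end HoughtonComplex

/-! ### Simple connectivity -/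

theorem homotopic_refl_of_map {X : Type*} [TopologicalSpace X] {g : C(X, X)}
    (F : (ContinuousMap.id X).Homotopy g) {x : X} (γ : Path x x)
    (h : (γ.map (map_continuous g)).Homotopic (Path.refl (g x))) : γ.Homotopic (Path.refl x) := by
  set e : Path x (g x) := F.evalAt x
  have he : (γ.trans e).Homotopic (e.trans (γ.map (map_continuous g))) :=
    Path.Homotopic.map_trans_evalAt F γ
  rw [← Path.Homotopic.Quotient.eq] at h he ⊢
  rw [Path.Homotopic.Quotient.mk_trans, Path.Homotopic.Quotient.mk_trans, h] at he
  calc Path.Homotopic.Quotient.mk γ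
      = ((Path.Homotopic.Quotient.mk γ).trans (Path.Homotopic.Quotient.mk e)).trans
          (Path.Homotopic.Quotient.mk e).symm := by simp
    _ = Path.Homotopic.Quotient.mk (Path.refl x) := by
      rw [he]
      simp

theorem homotopic_refl_of_factor {X Z : Type*} [TopologicalSpace X] [TopologicalSpace Z]
    [SimplyConnectedSpace Z] (p : C(Z, X)) (q : C(X, Z)) {x : X} (γ : Path x x)
    (h : ∀ t, p (q (γ t)) = γ t) : γ.Homotopic (Path.refl x) := by
  have hx : x = p (q x) := by simpa using (h 0).symm
  have hq : (γ.map (map_continuous q)).Homotopic (Path.refl (q x)) :=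
    SimplyConnectedSpace.paths_homotopic _ _
  convert (hq.map p).pathCast hx hx
  · exact Path.ext (funext fun t => (h t).symm)
  · exact Path.ext (funext fun _ => hx)

namespace CubeFilling

variable {V : Type} {G : SimpleGraph V} [T1Space (CubeFilling G)]

theorem isClosed_of_finite_inter_range_charMap {A : Set (CubeFilling G)}
    (h : ∀ f, (A ∩ range (charMap f)).Finite) : IsClosed A := by
  rw [← isOpen_compl_iff, isOpen_iff]
  intro f
  rw [preimage_compl, ← preimage_inter_range]
  exact ((h f).isClosed.preimage (continuous_charMap f)).isOpen_compl

theorem finite_of_subset_isCompact {A K : Set (CubeFilling G)} (hK : IsCompact K) (hA : A ⊆ K)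
    (h : ∀ f, (A ∩ range (charMap f)).Finite) : A.Finite := by
  have hclosed {B : Set (CubeFilling G)} (hB : B ⊆ A) : IsClosed B :=
    isClosed_of_finite_inter_range_charMap fun f => (h f).subset (by gcongr)
  have hdiscrete : DiscreteTopology A := by
    refine discreteTopology_iff_forall_isClosed.2 fun s => ?_
    rw [← preimage_image_eq s Subtype.val_injective]
    exact (hclosed (Subtype.coe_image_subset A s)).preimage continuous_subtype_val
  exact (hK.of_isClosed_subset (hclosed subset_rfl) hA).finite ⟨hdiscrete⟩

theorem exists_subset_of_isCompact {U : ℕ → Set (CubeFilling G)} (hU : Monotone U)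
    (h : ∀ f : ParamCube G, ∃ N, ∀ x, charMap f x ∈ U N) {K : Set (CubeFilling G)}
    (hK : IsCompact K) : ∃ N, K ⊆ U N := by
  by_contra! hcon
  choose y hyK hyU using fun N => not_subset.1 (hcon N)
  have hfin : (range y).Finite := by
    refine finite_of_subset_isCompact hK (range_subset_iff.2 hyK) fun f => ?_
    obtain ⟨N, hN⟩ := h f
    refine ((finite_Iio N).image y).subset ?_
    rintro _ ⟨⟨M, rfl⟩, x, hx⟩
    refine mem_image_of_mem y (mem_Iio.2 (not_le.1 fun hNM => hyU M ?_))
    exact hU hNM (hx ▸ hN x)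
  have hmem (z : CubeFilling G) : ∃ N, z ∈ U N := by
    obtain ⟨f, x⟩ := z
    exact (h f).imp fun N hN => hN x
  choose N hN using hmem
  obtain ⟨M, hM⟩ := (hfin.image N).bddAbove
  exact hyU M (hU (hM (mem_image_of_mem N (mem_range_self M))) (hN (y M)))

end CubeFilling

namespace HoughtonComplex

open HoughtonMonoid CubeFilling
open scoped NNReal

variable {n : ℕ}

theorem isQuotientMap_pt : IsQuotientMap
    fun p : (Σ _ : HoughtonMonoid n, Fin n → ℝ) => pt p.1 p.2 := by
  refine (isQuotientMap_iff _).2 ⟨isCoinducing_iff.2 fun U => ⟨fun hU => ?_, fun hU => ?_⟩,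
    fun z => ?_⟩
  · refine isOpen_iff.2 fun f => ?_
    obtain ⟨β, ι, s, -, h⟩ := exists_charMap_eq f
    have hc : Continuous fun x : SolidCube f.1 => cellVec ι (signVec s * (x : Fin f.1 → ℝ)) :=
      (continuous_cellVec ι).comp (continuous_const.mul continuous_subtype_val)
    convert (isOpen_sigma_iff.1 hU β).preimage hc using 1
    ext x
    simp [h]
  · exact hU.preimage (continuous_sigma continuous_pt)
  · obtain ⟨α, v, -, h⟩ := exists_pt_eq z
    exact ⟨⟨α, v⟩, h⟩

/-- The flow on the complex that increases all coordinates of the orthants at unit speed. It is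
defined by the position of a point in its open cell. -/
noncomputable def flow (s : ℝ≥0) (z : HoughtonComplex n) : HoughtonComplex n :=
  pt (exists_pt_eq z).choose fun i => (exists_pt_eq z).choose_spec.choose i + s

theorem flow_pt (s : ℝ≥0) (α : HoughtonMonoid n) (v : Fin n → ℝ) :
    flow s (pt α v) = pt α fun i => max (v i) 0 + s := by
  obtain ⟨hw, hpt⟩ := (exists_pt_eq (pt α v)).choose_spec.choose_spec
  obtain ⟨hα, hv⟩ :=
    pt_injective hw (fun i => fract_mem_Ico (max (v i) 0)) (hpt.trans (pt_eq_pt_fract α v))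
  refine (congrArg₂ (fun β (w : Fin n → ℝ) => pt β fun i => w i + s) hα hv).trans ?_
  rw [← pt_add α (fun i => ⌊v i⌋₊) (v := fun i => Int.fract (max (v i) 0) + s)
    fun i => add_nonneg (fract_mem_Ico _).1 s.2]
  congr 1
  funext i
  linarith [natFloor_add_fract_max (v i)]

theorem flow_zero (z : HoughtonComplex n) : flow 0 z = z := by
  obtain ⟨α, v, -, rfl⟩ := exists_pt_eq z
  simp [flow_pt, pt_max]

theorem flow_add (s t : ℝ≥0) (z : HoughtonComplex n) : flow (s + t) z = flow s (flow t z) := by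
  obtain ⟨α, v, -, rfl⟩ := exists_pt_eq z
  rw [flow_pt, flow_pt, flow_pt]
  congr 1
  funext i
  have hnonneg : 0 ≤ max (v i) 0 + (t : ℝ) := add_nonneg (le_max_right _ _) t.2
  rw [max_eq_left hnonneg, NNReal.coe_add]
  ring

theorem continuous_uncurry_flow :
    Continuous fun p : HoughtonComplex n × ℝ≥0 => flow p.2 p.1 := by
  refine isQuotientMap_pt.continuous_lift_prod_left ?_
  simp only [flow_pt]
  rw [← Homeomorph.comp_continuous_iff' Homeomorph.sigmaProdDistrib.symm]
  refine continuous_sigma fun α => (continuous_pt α).comp ?_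
  change Continuous fun p : (Fin n → ℝ) × ℝ≥0 => fun i => max (p.1 i) 0 + (p.2 : ℝ)
  fun_prop

theorem continuous_flow {Z : Type*} [TopologicalSpace Z] {s : Z → ℝ≥0}
    {f : Z → HoughtonComplex n} (hs : Continuous s) (hf : Continuous f) :
    Continuous fun z => flow (s z) (f z) := by
  simpa only [Function.comp_def] using continuous_uncurry_flow.comp (hf.prodMk hs)

/-- The flow at time `s` as a continuous map. -/
noncomputable def flowMap (n : ℕ) (s : ℝ≥0) : C(HoughtonComplex n, HoughtonComplex n) :=
  ⟨flow s, continuous_flow continuous_const continuous_id⟩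

/-- The flow up to time `s` as a homotopy from the identity. -/
noncomputable def flowHomotopy (n : ℕ) (s : ℝ≥0) :
    (ContinuousMap.id (HoughtonComplex n)).Homotopy (flowMap n s) where
  toFun p := flow (s * unitInterval.toNNReal p.1) p.2
  continuous_toFun := continuous_flow (by fun_prop) continuous_snd
  map_zero_left z := by simp [flow_zero]
  map_one_left z := by simp [flowMap]

theorem exists_flow_charMap_mem_range_pt (α : HoughtonMonoid n) (f : ParamCube (cayleyGraph n)) :
    ∃ N : ℕ, ∀ x, flow N (charMap f x) ∈ range (pt α) := by
  obtain ⟨β, ι, s, -, h⟩ := exists_charMap_eq f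
  obtain ⟨N, b, hb⟩ := exists_const_vadd_eq_vadd β α
  refine ⟨N, fun x => ?_⟩
  rw [h, flow_pt, NNReal.coe_natCast, pt_add β (fun _ => N) fun i => le_max_right _ _, hb,
    ← pt_add α b fun i => le_max_right _ _]
  exact mem_range_self _

theorem flow_mem_range_pt {α : HoughtonMonoid n} {z : HoughtonComplex n} (s : ℝ≥0)
    (hz : z ∈ range (pt α)) : flow s z ∈ range (pt α) := by
  obtain ⟨v, rfl⟩ := hz
  exact ⟨_, (flow_pt s α v).symm⟩

theorem exists_flow_mem_range_pt_of_isCompact (α : HoughtonMonoid n) {K : Set (HoughtonComplex n)}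
    (hK : IsCompact K) : ∃ N : ℕ, ∀ z ∈ K, flow N z ∈ range (pt α) := by
  refine exists_subset_of_isCompact (U := fun N : ℕ => {z | flow N z ∈ range (pt α)})
    (monotone_nat_of_le_succ fun N z hz => ?_) (exists_flow_charMap_mem_range_pt α) hK
  rw [mem_ofPred_eq, Nat.cast_succ, add_comm, flow_add]
  exact flow_mem_range_pt 1 hz

theorem pt_height_sub_shift {α : HoughtonMonoid n} {z : HoughtonComplex n}
    (hz : z ∈ range (pt α)) : pt α (fun i => height z i - α.shift i) = z := by
  obtain ⟨v, rfl⟩ := hz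
  simpa [height_pt] using pt_max α v

instance : PathConnectedSpace (HoughtonComplex n) := by
  refine ⟨⟨pt 1 0⟩, fun y z => ?_⟩
  obtain ⟨N, hN⟩ := exists_flow_mem_range_pt_of_isCompact 1 (Set.toFinite {y, z}).isCompact
  have hflow (x : HoughtonComplex n) : Joined x (flow N x) := ⟨(flowHomotopy n N).evalAt x⟩
  have hrange : Joined (flow N y) (flow N z) :=
    ((isPathConnected_range (continuous_pt 1)).joinedIn _ (hN y (by simp)) _
      (hN z (by simp))).joined
  exact (hflow y).trans (hrange.trans (hflow z).symm)

instance : SimplyConnectedSpace (HoughtonComplex n) := by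
  refine simply_connected_iff_loops_nullhomotopic.2 ⟨inferInstance, fun x γ => ?_⟩
  obtain ⟨N, hN⟩ := exists_flow_mem_range_pt_of_isCompact 1 (isCompact_range γ.continuous)
  refine homotopic_refl_of_map (flowHomotopy n N) γ ?_
  have hq : Continuous fun (z : HoughtonComplex n) i =>
      height z i - (HoughtonMonoid.shift (1 : HoughtonMonoid n) i : ℝ) := by
    have := continuous_height (n := n)
    fun_prop
  exact homotopic_refl_of_factor ⟨pt 1, continuous_pt 1⟩ ⟨_, hq⟩ _ fun t =>
    pt_height_sub_shift (hN _ (mem_range_self t))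

end HoughtonComplex

/-! ### Links of vertices -/

/-- The simplices are the nonempty finite sets whose elements are pairwise related by `r`. -/
def cliqueComplex {W : Type*} (r : W → W → Prop) : AbstractSimplicialComplex W where
  faces := {s | s.Nonempty ∧ (s : Set W).Pairwise r}
  isRelLowerSet_faces := fun _ hs =>
    ⟨hs.1, fun _ hts ht => ⟨ht, hs.2.mono (Finset.coe_subset.2 hts)⟩⟩
  singleton_mem _ := by simp

theorem isFlag_cliqueComplex {W : Type u} {r : W → W → Prop}
    (hfin : ∀ S : Set W, S.Pairwise r → S.Finite) : (cliqueComplex r).IsFlag := by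
  intro S hS hadj
  have hclique : S.Pairwise r := by
    intro v hv w hw hne
    obtain ⟨s, hs, hsvw⟩ := hadj v hv w hw hne
    exact hs.2 (by simp [hsvw]) (by simp [hsvw]) hne
  have hcoe := (hfin S hclique).coe_toFinset
  exact ⟨_, ⟨by simpa using hS, by rwa [hcoe]⟩, hcoe⟩

namespace HoughtonMonoid

variable {n : ℕ} {α β γ : HoughtonMonoid n}

theorem apply_notMem_range_vadd {a : Fin n → ℕ} {k : Fin n} {p : ℕ} (hp : p < a k) :
    β.1 (k, p) ∉ range (a +ᵥ β).1 := by
  rintro ⟨⟨l, q⟩, h⟩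
  obtain ⟨rfl, h⟩ := Prod.mk.inj (β.2.1 h)
  omega

theorem eq_of_vadd_eq_of_lt {a : Fin n → ℕ} (h : a +ᵥ β = a +ᵥ γ)
    (hlt : ∀ k p, p < a k → β.1 (k, p) = γ.1 (k, p)) : β = γ := by
  refine ext fun k p => ?_
  obtain hp | hp := lt_or_ge p (a k)
  · exact hlt k p hp
  · have hval := congrArg (fun δ => δ.1 (k, p - a k)) h
    simpa only [vadd_apply, Nat.sub_add_cancel hp] using hval

theorem eq_of_vadd_update_eq {a : Fin n → ℕ} (h : a +ᵥ β = a +ᵥ γ)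
    (hupd : ∀ i, a i ≠ 0 → Function.update a i 0 +ᵥ β = Function.update a i 0 +ᵥ γ) : β = γ :=
  eq_of_vadd_eq_of_lt h fun k p hp => by
    simpa [vadd_apply] using congrArg (fun δ => δ.1 (k, p)) (hupd k (by omega))

theorem eq_of_vadd_eq_of_vadd_update_eq {a b : Fin n → ℕ} {i : Fin n} (h : a +ᵥ β = b +ᵥ γ)
    (hupd : Function.update a i 0 +ᵥ β = Function.update b i 0 +ᵥ γ) : a i = b i := by
  have hs := congrArg (fun δ => shift δ i) h
  have hs' := congrArg (fun δ => shift δ i) hupd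
  simp only [shift_vadd, Function.update_self] at hs hs'
  omega

/-- The values `x (k, p)` for `p < a k` are inserted at the beginnings of the rays. -/
theorem exists_vadd_eq (α : HoughtonMonoid n) (a : Fin n → ℕ) {x : Rays n → Rays n}
    (hx : InjOn x {y | y.2 < a y.1}) (hxα : ∀ y : Rays n, y.2 < a y.1 → x y ∉ range α.1) :
    ∃ β : HoughtonMonoid n, a +ᵥ β = α ∧ ∀ y : Rays n, y.2 < a y.1 → β.1 y = x y := by
  classical
  set f : Rays n → Rays n :=
    piecewise {y | y.2 < a y.1} x fun y => α.1 (y.1, y.2 - a y.1)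
  have hf_of_lt (y : Rays n) (hy : y.2 < a y.1) : f y = x y := piecewise_eq_of_mem _ _ _ hy
  have hf_of_le (y : Rays n) (hy : a y.1 ≤ y.2) : f y = α.1 (y.1, y.2 - a y.1) :=
    piecewise_eq_of_notMem _ _ _ hy.not_gt
  have hf : Function.Injective f := by
    refine (injective_piecewise_iff _).2 ⟨hx, ?_, fun y hy z _ h => hxα y hy ⟨_, h.symm⟩⟩
    rintro ⟨k, p⟩ hp ⟨l, q⟩ hq h
    obtain ⟨rfl, h⟩ := Prod.mk.inj (α.2.1 h)
    exact Prod.ext rfl (tsub_inj_left (not_lt.1 hp) (not_lt.1 hq) h)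
  obtain ⟨N, hN⟩ := α.exists_eq_add_shift
  refine ⟨⟨f, hf, fun k => α.shift k - a k, Finset.univ.biUnion fun k =>
    {k} ×ˢ Finset.range (N + a k), fun k p hkp => ?_⟩, ext fun k p => ?_, hf_of_lt⟩
  · have hp : N + a k ≤ p := by simpa using hkp
    obtain ⟨hray, hpos⟩ := hN k (p - a k) (by omega)
    rw [hf_of_le _ (by dsimp only; omega)]
    exact ⟨hray, by dsimp only; omega⟩
  · change f (k, p + a k) = α.1 (k, p)
    rw [hf_of_le _ (Nat.le_add_left _ _), Nat.add_sub_cancel]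

/-- Compatible edges at a vertex: the upper ends `α` of edges are obtained from their lower ends
`γ i` by forgetting one value, and distinct forgotten values can be inserted simultaneously. -/
theorem exists_vadd_eq_of_pairwise {D : Set (Fin n)} {γ : Fin n → HoughtonMonoid n}
    (hγ : ∀ i ∈ D, γ i = α ∨ (Pi.single i 1 : Fin n → ℕ) +ᵥ γ i = α)
    (hD : D.Pairwise fun i j => γ i ≠ α → γ j ≠ α → (γ i).1 (i, 0) ≠ (γ j).1 (j, 0)) :
    ∃ (β : HoughtonMonoid n) (a : Fin n → ℕ), a ≤ 1 ∧ Function.support a ⊆ D ∧ a +ᵥ β = α ∧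
      ∀ i ∈ D, γ i = Function.update a i 0 +ᵥ β := by
  classical
  set a : Fin n → ℕ := {i | i ∈ D ∧ γ i ≠ α}.indicator 1 with ha_def
  have ha (i : Fin n) (p : ℕ) : p < a i ↔ p = 0 ∧ i ∈ D ∧ γ i ≠ α := by
    simp only [ha_def, indicator_apply]
    split_ifs with h <;> simp_all
  obtain ⟨β, hβ, hβ'⟩ := α.exists_vadd_eq a (x := fun y => (γ y.1).1 (y.1, 0)) (by
    rintro ⟨i, p⟩ hi ⟨j, q⟩ hj h
    obtain ⟨rfl, hi, hiα⟩ := (ha i p).1 hi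
    obtain ⟨rfl, hj, hjα⟩ := (ha j q).1 hj
    rw [hD.eq hi hj fun hne => hne hiα hjα h]) (by
    rintro ⟨i, p⟩ hi
    obtain ⟨-, hi, hiα⟩ := (ha i p).1 hi
    rw [← (hγ i hi).resolve_left hiα]
    exact apply_notMem_range_vadd (by simp))
  refine ⟨β, a, fun i => not_lt.1 fun h => one_ne_zero ((ha i 1).1 h).1,
    fun i hi => ((ha i 0).1 (Nat.pos_of_ne_zero hi)).2.1, hβ, fun i hi => ?_⟩
  by_cases hiα : γ i = α
  · rw [hiα, ← hβ, Function.update_eq_self_iff.2]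
    simp [ha_def, hiα]
  · have hai : a i = 1 := by simp [ha_def, hi, hiα]
    have hsum : Pi.single i 1 + Function.update a i 0 = a := by
      funext j
      obtain rfl | hj := eq_or_ne j i <;> simp [*]
    refine eq_of_vadd_eq_of_lt (a := Pi.single i 1) ?_ fun k p hp => ?_
    · rw [(hγ i hi).resolve_left hiα, ← add_vadd, hsum, hβ]
    · obtain ⟨rfl, rfl⟩ : k = i ∧ p = 0 := by
        obtain rfl | hk := eq_or_ne k i <;> simp_all
      simpa [vadd_apply] using (hβ' (k, 0) (by simp [hai])).symm

end HoughtonMonoid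

namespace HoughtonComplex

open HoughtonMonoid CubeFilling

variable {n k : ℕ} {c : Cell n k} {e : Cell n 1} {α : HoughtonMonoid n}

theorem pt_vadd_mem_closedCell {a : Fin n → ℕ} {w : Fin n → ℝ} (ha : a ≤ 1)
    (hac : Function.support a ⊆ range c.2) (hw : ∀ i, 0 ≤ w i ∧ w i ≤ 1)
    (hwc : Function.support w ⊆ range c.2) (haw : ∀ i, a i ≠ 0 → w i = 0) :
    pt (a +ᵥ c.1) w ∈ closedCell c := by
  rw [← pt_add c.1 a fun i => (hw i).1]
  refine pt_mem_closedCell (fun i => ?_) fun i hi => ?_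
  · obtain h | h := Nat.le_one_iff_eq_zero_or_eq_one.1 (ha i)
    · simpa [h] using hw i
    · simp [h, haw i]
  · by_cases h : a i = 0
    · exact hwc (by simpa [h] using hi)
    · exact hac h

theorem exists_vadd_eq_of_pt_mem_closedCell {γ : HoughtonMonoid n} {w : Fin n → ℝ}
    (hw : ∀ i, 0 ≤ w i ∧ w i < 1) (h : pt γ w ∈ closedCell c) :
    ∃ a : Fin n → ℕ, a ≤ 1 ∧ Function.support a ⊆ range c.2 ∧ a +ᵥ c.1 = γ ∧
      Function.support w ⊆ range c.2 ∧ ∀ i, a i ≠ 0 → w i = 0 := by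
  obtain ⟨x, hx, h⟩ := h
  have hu := cellVec_mem_Icc c.2 hx
  have hu_notMem (i : Fin n) (hi : i ∉ range c.2) := cellVec_of_notMem c.2 x hi
  rw [cellMap] at h
  generalize cellVec c.2 x = u at h hu hu_notMem
  rw [pt_eq_pt_fract] at h
  obtain ⟨hγ, rfl⟩ := pt_injective (fun i => fract_mem_Ico _) hw h
  refine ⟨_, fun i => Nat.floor_le_one_of_le_one (hu i).2, fun i hi => ?_, hγ, fun i hi => ?_,
    fun i hi => ?_⟩
  · by_contra hic
    simp [hu_notMem i hic] at hi
  · by_contra hic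
    simp [hu_notMem i hic] at hi
  · by_contra hfract
    change Int.fract (max (u i) 0) ≠ 0 at hfract
    rw [max_eq_left (hu i).1] at hfract
    exact hi (natFloor_eq_zero_of_fract_ne_zero (hu i).2 hfract)

theorem pt_zero_mem_closedCell_iff : pt α 0 ∈ closedCell c ↔
    ∃ a : Fin n → ℕ, a ≤ 1 ∧ Function.support a ⊆ range c.2 ∧ a +ᵥ c.1 = α := by
  constructor
  · intro h
    obtain ⟨a, ha, hac, haα, -⟩ := exists_vadd_eq_of_pt_mem_closedCell (fun _ => by simp) h
    exact ⟨a, ha, hac, haα⟩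
  · rintro ⟨a, ha, hac, rfl⟩
    exact pt_vadd_mem_closedCell ha hac (fun _ => by simp) (by simp) fun _ _ => rfl

theorem closedCell_subset_closedCell_iff {l : ℕ} {d : Cell n l} :
    closedCell d ⊆ closedCell c ↔ range d.2 ⊆ range c.2 ∧ ∃ a : Fin n → ℕ, a ≤ 1 ∧
      Function.support a ⊆ range c.2 ∧ a +ᵥ c.1 = d.1 ∧ ∀ i ∈ range d.2, a i = 0 := by
  constructor
  · intro h
    have hcenter : (0 : Fin l → ℝ) ∈ ball (0 : Fin l → ℝ) 1 := by simp
    obtain ⟨a, ha, hac, hd, hsupp, hzero⟩ := exists_vadd_eq_of_pt_mem_closedCell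
      (cellVec_mem_Ico d.2 hcenter) (h (mem_image_of_mem _ (ball_subset_closedBall hcenter)))
    rw [support_cellVec d.2 hcenter] at hsupp
    refine ⟨hsupp, a, ha, hac, hd, fun i hi => by_contra fun hai => ?_⟩
    rw [← support_cellVec d.2 hcenter] at hi
    exact hi (hzero i hai)
  · rintro ⟨hdc, a, ha, hac, hd, hzero⟩ _ ⟨x, hx, rfl⟩
    have hsupp : Function.support (cellVec d.2 x) ⊆ range d.2 := fun i hi =>
      by_contra fun hid => hi (cellVec_of_notMem d.2 x hid)
    rw [cellMap, ← hd]
    exact pt_vadd_mem_closedCell ha hac (cellVec_mem_Icc d.2 hx) (hsupp.trans hdc) fun i hai =>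
      by_contra fun hi => hai (hzero i (hsupp hi))

theorem range_edge (e : Cell n 1) : range e.2 = {e.2 0} :=
  range_unique

theorem edge_ext {e' : Cell n 1} (hbase : e.1 = e'.1) (hdir : e.2 0 = e'.2 0) : e = e' :=
  Prod.ext hbase (OrderEmbedding.range_inj.1 (by rw [range_edge, range_edge, hdir]))

theorem pt_zero_mem_edge_iff :
    pt α 0 ∈ closedCell e ↔ e.1 = α ∨ (Pi.single (e.2 0) 1 : Fin n → ℕ) +ᵥ e.1 = α := by
  rw [pt_zero_mem_closedCell_iff, range_edge]
  constructor
  · rintro ⟨a, ha, hae, rfl⟩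
    have ha_eq : a = Pi.single (e.2 0) (a (e.2 0)) := by
      funext i
      obtain rfl | hi := eq_or_ne i (e.2 0)
      · simp
      · simpa [hi] using fun h => hi (hae h)
    obtain h | h := Nat.le_one_iff_eq_zero_or_eq_one.1 (ha (e.2 0))
    · left
      rw [ha_eq, h, Pi.single_zero, zero_vadd]
    · right
      rw [ha_eq, h]
  · rintro (rfl | rfl)
    · exact ⟨0, by simp, by simp, zero_vadd _ _⟩
    · exact ⟨_, update_le_iff.2 ⟨le_rfl, fun _ _ => zero_le_one⟩, Pi.support_single_subset, rfl⟩

/-- The edges at the vertex `a +ᵥ c.1` of `c` go up in the directions `i` with `a i = 0`, and down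
in those with `a i = 1`. -/
theorem edge_subset_closedCell_iff {a : Fin n → ℕ} (ha : a ≤ 1)
    (hac : Function.support a ⊆ range c.2) (he : pt (a +ᵥ c.1) 0 ∈ closedCell e) :
    closedCell e ⊆ closedCell c ↔
      e.2 0 ∈ range c.2 ∧ e.1 = Function.update a (e.2 0) 0 +ᵥ c.1 := by
  rw [closedCell_subset_closedCell_iff, range_edge, singleton_subset_iff]
  refine and_congr_right fun hdir => ⟨?_, fun h => ?_⟩
  · rintro ⟨b, -, -, hb, hzero⟩
    rw [pt_zero_mem_edge_iff, ← hb, ← add_vadd] at he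
    rw [← hb]
    congr 1
    obtain h | h := he
    · rw [← vadd_left_injective c.1 h, Function.update_eq_self_iff.2 (hzero _ rfl).symm]
    · rw [← vadd_left_injective c.1 h]
      funext i
      obtain rfl | hi := eq_or_ne i (e.2 0)
      · simp [hzero]
      · simp [hi]
  · refine ⟨_, update_le_iff.2 ⟨zero_le_one, fun i _ => ha i⟩, ?_, h.symm, by simp⟩
    exact (Function.support_update_zero _ _).trans_subset (sdiff_subset.trans hac)

/-- The condition for two edges at `α` to span a square: they have different labels, and if they
both end at `α` then they insert different values. -/
def IsLinkAdj (α : HoughtonMonoid n) (e e' : Cell n 1) : Prop :=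
  e.2 0 ≠ e'.2 0 ∧ (e.1 ≠ α → e'.1 ≠ α → e.1.1 (e.2 0, 0) ≠ e'.1.1 (e'.2 0, 0))

theorem isLinkAdj_of_subset {e' : Cell n 1} (hc : pt α 0 ∈ closedCell c)
    (he : pt α 0 ∈ closedCell e) (he' : pt α 0 ∈ closedCell e') (hec : closedCell e ⊆ closedCell c)
    (hec' : closedCell e' ⊆ closedCell c) (hne : e ≠ e') : IsLinkAdj α e e' := by
  obtain ⟨a, ha, hac, rfl⟩ := pt_zero_mem_closedCell_iff.1 hc
  obtain ⟨-, hbase⟩ := (edge_subset_closedCell_iff ha hac he).1 hec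
  obtain ⟨-, hbase'⟩ := (edge_subset_closedCell_iff ha hac he').1 hec'
  have hdir : e.2 0 ≠ e'.2 0 := fun hdir => hne (edge_ext (by rw [hbase, hbase', hdir]) hdir)
  refine ⟨hdir, fun _ _ hval => hdir ?_⟩
  rw [hbase, hbase', vadd_apply, vadd_apply, Function.update_self, Function.update_self] at hval
  exact congrArg Prod.fst (c.1.2.1 hval)

theorem exists_cell_of_pairwise {S : Set (Cell n 1)} (hS : ∀ e ∈ S, pt α 0 ∈ closedCell e)
    (hadj : S.Pairwise (IsLinkAdj α)) : ∃ (k : ℕ) (c : Cell n k), pt α 0 ∈ closedCell c ∧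
      ∀ e : Cell n 1, pt α 0 ∈ closedCell e → (closedCell e ⊆ closedCell c ↔ e ∈ S) := by
  have hdir : InjOn (fun e : Cell n 1 => e.2 0) S := fun e he e' he' h =>
    by_contra fun hne => (hadj he he' hne).1 h
  obtain ⟨γ, hγ⟩ : ∃ γ : Fin n → HoughtonMonoid n, ∀ e ∈ S, γ (e.2 0) = e.1 :=
    ⟨_, fun e he => hdir.injective.extend_apply (fun e : S => e.1.1) (fun _ => α) ⟨e, he⟩⟩
  obtain ⟨k, ι, hι⟩ := exists_orderEmbedding_range_eq ((fun e : Cell n 1 => e.2 0) '' S)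
  obtain ⟨β, a, ha, hac, hβ, hbase⟩ := exists_vadd_eq_of_pairwise (α := α) (D := range ι) (γ := γ)
    (by
      rw [hι]
      rintro _ ⟨e, he, rfl⟩
      dsimp only
      rw [hγ e he]
      exact pt_zero_mem_edge_iff.1 (hS e he))
    (by
      rw [hι]
      rintro _ ⟨e, he, rfl⟩ _ ⟨e', he', rfl⟩ hne
      dsimp only
      rw [hγ e he, hγ e' he']
      exact (hadj he he' fun h => hne (by rw [h])).2)
  refine ⟨k, (β, ι), pt_zero_mem_closedCell_iff.2 ⟨a, ha, hac, hβ⟩, fun e he => ?_⟩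
  rw [edge_subset_closedCell_iff (c := (β, ι)) ha hac (by rwa [hβ])]
  constructor
  · rintro ⟨hmem, he_base⟩
    obtain ⟨e', he', hee'⟩ := hι.le hmem
    rw [← hbase _ hmem, ← hee', hγ e' he'] at he_base
    rwa [edge_ext he_base hee'.symm]
  · intro heS
    have hmem : e.2 0 ∈ range ι := hι.ge ⟨e, heS, rfl⟩
    exact ⟨hmem, by rw [← hbase _ hmem, hγ e heS]⟩

theorem exists_edge_subset {a : Fin n → ℕ} (ha : a ≤ 1) (hac : Function.support a ⊆ range c.2)
    {i : Fin n} (hi : i ∈ range c.2) :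
    ∃ e : Cell n 1, e.1 = Function.update a i 0 +ᵥ c.1 ∧ e.2 0 = i ∧
      pt (a +ᵥ c.1) 0 ∈ closedCell e ∧ closedCell e ⊆ closedCell c := by
  obtain ⟨e, hbase, rfl⟩ : ∃ e : Cell n 1, e.1 = Function.update a i 0 +ᵥ c.1 ∧ e.2 0 = i :=
    ⟨(_, OrderEmbedding.ofStrictMono (fun _ => i) (Subsingleton.strictMono _)), rfl, rfl⟩
  have he : pt (a +ᵥ c.1) 0 ∈ closedCell e := by
    rw [pt_zero_mem_edge_iff, hbase, ← add_vadd]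
    obtain h | h := Nat.le_one_iff_eq_zero_or_eq_one.1 (ha (e.2 0))
    · left
      rw [Function.update_eq_self_iff.2 h.symm]
    · right
      congr 1
      funext j
      obtain rfl | hj := eq_or_ne j (e.2 0) <;> simp [*]
  exact ⟨e, hbase, rfl, he, (edge_subset_closedCell_iff ha hac he).2 ⟨hi, hbase⟩⟩

theorem vadd_update_eq_of_edges_subset {l : ℕ} {d : Cell n l} {a b : Fin n → ℕ} (ha : a ≤ 1)
    (hac : Function.support a ⊆ range c.2) (hb : b ≤ 1) (hbd : Function.support b ⊆ range d.2)
    (hab : a +ᵥ c.1 = b +ᵥ d.1)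
    (h : ∀ e : Cell n 1, pt (a +ᵥ c.1) 0 ∈ closedCell e → closedCell e ⊆ closedCell c →
      closedCell e ⊆ closedCell d) {i : Fin n} (hi : i ∈ range c.2) :
    i ∈ range d.2 ∧ Function.update a i 0 +ᵥ c.1 = Function.update b i 0 +ᵥ d.1 := by
  obtain ⟨e, hbase, rfl, he, hec⟩ := exists_edge_subset ha hac hi
  rw [← hbase]
  exact (edge_subset_closedCell_iff hb hbd (by rwa [← hab])).1 (h e he hec)

theorem cell_eq_of_edges_subset_iff {l : ℕ} {d : Cell n l} (hc : pt α 0 ∈ closedCell c)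
    (hd : pt α 0 ∈ closedCell d)
    (h : ∀ e : Cell n 1, pt α 0 ∈ closedCell e →
      (closedCell e ⊆ closedCell c ↔ closedCell e ⊆ closedCell d)) :
    (⟨k, c⟩ : Σ k, Cell n k) = ⟨l, d⟩ := by
  obtain ⟨a, ha, hac, rfl⟩ := pt_zero_mem_closedCell_iff.1 hc
  obtain ⟨b, hb, hbd, hba⟩ := pt_zero_mem_closedCell_iff.1 hd
  have hcd (i : Fin n) (hi : i ∈ range c.2) :=
    vadd_update_eq_of_edges_subset ha hac hb hbd hba.symm (fun e he => (h e he).1) hi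
  have hdc (i : Fin n) (hi : i ∈ range d.2) :=
    vadd_update_eq_of_edges_subset hb hbd ha hac hba (fun e he => (h e (hba ▸ he)).2) hi
  have hrange : range c.2 = range d.2 :=
    Subset.antisymm (fun i hi => (hcd i hi).1) fun i hi => (hdc i hi).1
  obtain rfl : a = b := by
    funext i
    by_cases hi : i ∈ range c.2
    · exact eq_of_vadd_eq_of_vadd_update_eq hba.symm (hcd i hi).2
    · rw [Function.notMem_support.1 fun h => hi (hac h),
        Function.notMem_support.1 fun h => hi (hrange ▸ hbd h)]
  have hbase : c.1 = d.1 := eq_of_vadd_update_eq hba.symm fun i hi => (hcd i (hac hi)).2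
  obtain rfl : k = l := by
    rw [← ncard_range_orderEmbedding c.2, hrange, ncard_range_orderEmbedding]
  rw [Prod.ext hbase (OrderEmbedding.range_inj.1 hrange)]

theorem point_cubicalComplex (v : Cell n 0) : (cubicalComplex n).point v = pt v.1 0 := by
  change pt v.1 (cellVec v.2 0) = pt v.1 0
  congr 1
  exact funext fun i => cellVec_of_notMem _ _ fun ⟨a, _⟩ => a.elim0

theorem point_mem_cube_iff {v : Cell n 0} :
    (cubicalComplex n).point v ∈ (cubicalComplex n).cube k c ↔ pt v.1 0 ∈ closedCell c := by
  rw [← point_cubicalComplex]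
  rfl

theorem exists_linkSimplex_eq_iff {v : Cell n 0} {S : Set ((cubicalComplex n).LinkVertex v)} :
    (∃ c, (cubicalComplex n).linkSimplex v c = S) ↔
      S.Pairwise fun e e' => IsLinkAdj v.1 e.1 e'.1 := by
  constructor
  · rintro ⟨c, rfl⟩ e he e' he' hne
    exact isLinkAdj_of_subset (point_mem_cube_iff.1 c.2) (point_mem_cube_iff.1 e.2)
      (point_mem_cube_iff.1 e'.2) he he' fun h => hne (Subtype.ext h)
  · intro hS
    obtain ⟨k, c, hc, h⟩ := exists_cell_of_pairwise (α := v.1) (S := Subtype.val '' S)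
      (by
        rintro _ ⟨e, -, rfl⟩
        exact point_mem_cube_iff.1 e.2)
      (by
        rintro _ ⟨e, he, rfl⟩ _ ⟨e', he', rfl⟩ hne
        exact hS he he' fun h => hne (congrArg Subtype.val h))
    exact ⟨⟨⟨k, c⟩, point_mem_cube_iff.2 hc⟩, Set.ext fun e =>
      (h e.1 (point_mem_cube_iff.1 e.2)).trans Subtype.val_injective.mem_set_image⟩

theorem linkSimplex_injective (v : Cell n 0) :
    Function.Injective ((cubicalComplex n).linkSimplex v) := fun c d hcd =>
  Subtype.ext <| cell_eq_of_edges_subset_iff (point_mem_cube_iff.1 c.2)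
    (point_mem_cube_iff.1 d.2) fun e he => Set.ext_iff.1 hcd ⟨e, point_mem_cube_iff.2 he⟩

theorem hasFlagLink (v : Cell n 0) : (cubicalComplex n).HasFlagLink v := by
  refine ⟨linkSimplex_injective v, cliqueComplex fun e e' => IsLinkAdj v.1 e.1 e'.1,
    fun s => and_congr_right fun _ => exists_linkSimplex_eq_iff.symm,
    isFlag_cliqueComplex fun S hS => ?_⟩
  have hdir : InjOn (fun e : (cubicalComplex n).LinkVertex v => (show Cell n 1 from e.1).2 0) S :=
    fun e he e' he' h => by_contra fun hne => (hS he he' hne).1 h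
  exact Set.Finite.of_finite_image (Set.toFinite _) hdir

end HoughtonComplex

theorem mainTheorem5 (n : ℕ) (hn : 1 ≤ n) :
    ∃ K : CubicalComplex (HoughtonComplex n), CubeFilling.IsStandard K ∧ K.IsCubing :=
  ⟨HoughtonComplex.cubicalComplex n, HoughtonComplex.isStandard_cubicalComplex n,
    inferInstance, HoughtonComplex.hasFlagLink⟩
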